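/- Let $\mathbb K$ be a field, $G$ an abelian group and $A=\bigoplus_{\gamma\in G}A_\gamma$ a $G$-graded $\mathbb K$-algebra. Write $A^o$ for the opposite algebra and $A^e=A\otimes_{\mathbb K}A^o$, and let $\mathrm{Mod}^G A^e$ be the category of $G$-graded $A$-bimodules (equivalently, graded left $A^e$-modules) with degree-preserving morphisms. For $\gamma\in G$ the shift $\Sigma_\gamma M$ of $M$ has $(\Sigma_\gamma M)_{\gamma'}=M_{\gamma+\gamma'}$. Put $$\underline{\mathrm{Ext}}^{i,G}_{A^e}(A,A^e)=\bigoplus_{\gamma\in G}\mathrm{Ext}^i_{\mathrm{Mod}^G A^e}(A,\Sigma_\gamma A^e),\qquad i\ge 0,$$ a $G$-graded $A$-bimodule through the right multiplications of $A^e$ on itself; for $i<0$ it is $0$. Let $\mathrm{Aut}_G(A)$ be the group of degree-preserving algebra automorphisms of $A$; for $\mu\in\mathrm{Aut}_G(A)$ let ${}^1\!A^\mu$ be the graded bimodule $A$ with actions $a*m*b=a\,m\,\mu(b)$. **Proposition.** Let $R$ be a $G$-graded $\mathbb K$-algebra and let $\hbar\in R$ be a homogeneous element of degree $\varepsilon$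 which is regular (neither a left nor a right zero divisor), normal ($\hbar R=R\hbar$) and not invertible. Let $\bar R=R/\hbar R$ with the induced grading, and let $\tau_\hbar\in\mathrm{Aut}_G(R)$ be the automorphism determined by $\hbar a=\tau_\hbar(a)\hbar$ for all $a\in R$. Let $d\ge 0$ be an integer and assume that, for some $\mu\in\mathrm{Aut}_G(R)$ and $\mathfrak l\in G$, $$\underline{\mathrm{Ext}}^{i,G}_{R^e}(R,R^e)=0\ \text{ for } i\ne d,\qquad \underline{\mathrm{Ext}}^{d,G}_{R^e}(R,R^e)\cong\Sigma_{\mathfrak l}\,{}^1\!R^{\mu}\ \text{ as $G$-graded $R$-bimodules.}$$ Then $d\ge 1$, the automorphisms $\mu$ and $\tau_\hbar$ induce automorphisms $\bar\mu,\bar\tau_\hbar\in\mathrm{Aut}_G(\bar R)$, and $$\underline{\mathrm{Ext}}^{i,G}_{\bar R^e}(\bar R,\bar R^e)=0\ \text{ for } i\ne d-1,\qquad \underline{\mathrm{Ext}}^{d-1,G}_{\bar R^e}(\bar R,\bar R^e)\cong\Sigma_{\mathfrak l-\varepsilon}\,{}^1\!\bar R^{\bar\mu\circ\bar\tau_\hbar}\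 \text{ as $G$-graded $\bar R$-bimodules.}$$ -/

import Mathlib

open CategoryTheory CategoryTheory.Limits
open scoped TensorProduct

universe w v v' u k

namespace SkewCY

/-- Families of subspaces of the algebra `A` indexed by `G`. -/
abbrev Grading (K : Type k) (G : Type w) (A : Type u) [Field K] [Ring A] [Algebra K A] :
    Type max w u :=
  G → Submodule K A

section GradedModules

variable {K : Type k} {G : Type w} {A : Type u} [Field K] [AddCommGroup G] [Ring A] [Algebra K A]

/-- A `G`-graded left module `M = ⨁ M_γ` over the `G`-graded algebra `A = ⨁ A_γ` (where `A_γ` is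
`𝒜 γ`), given by its homogeneous pieces `M_γ` and the biadditive actions
`A_α × M_β → M_γ`, `α + β = γ`. The `K`-linear structure is the action of `K ⊆ A_0`. -/
structure GrMod (𝒜 : Grading K G A) [SetLike.GradedMonoid 𝒜] where
  /-- the homogeneous pieces -/
  obj : G → Type v
  [addCommGroup : ∀ γ, AddCommGroup (obj γ)]
  /-- the action of homogeneous elements -/
  act : ∀ {α β γ : G}, α + β = γ → 𝒜 α →+ obj β →+ obj γ
  one_act : ∀ {γ : G} (h : 0 + γ = γ) (m : obj γ),
    act h ⟨1, SetLike.GradedOne.one_mem⟩ m = m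
  mul_act : ∀ {α β γ δ ζ : G} (h₁ : β + γ = δ) (h₂ : α + δ = ζ) (h : (α + β) + γ = ζ)
    (a : 𝒜 α) (b : 𝒜 β) (m : obj γ),
    act h ⟨a * b, SetLike.GradedMul.mul_mem a.2 b.2⟩ m = act h₂ a (act h₁ b m)

attribute [instance] GrMod.addCommGroup

namespace GrMod

variable {𝒜 : Grading K G A} [SetLike.GradedMonoid 𝒜]

/-- Morphisms of graded modules: the `A`-linear maps that preserve degrees. -/
@[ext]
structure Hom (M N : GrMod.{w, v, u, k} 𝒜) where
  /-- the components -/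
  app : ∀ γ, M.obj γ →+ N.obj γ
  map_act : ∀ {α β γ : G} (h : α + β = γ) (a : 𝒜 α) (m : M.obj β),
    app γ (M.act h a m) = N.act h a (app β m)

/-- The category `Mod^G A`. -/
instance : Category (GrMod.{w, v, u, k} 𝒜) where
  Hom M N := Hom M N
  id M := { app := fun γ => AddMonoidHom.id _, map_act := fun _ _ _ => rfl }
  comp f g :=
    { app := fun γ => (g.app γ).comp (f.app γ)
      map_act := fun h a m => by simp [f.map_act, g.map_act] }

variable {M N P : GrMod.{w, v, u, k} 𝒜}

@[ext]
theorem hom_ext {f g : M ⟶ N} (h : ∀ γ m, f.app γ m = g.app γ m) : f = g :=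
  Hom.ext (funext fun γ => AddMonoidHom.ext (h γ))

@[simp] theorem id_app (γ : G) (m : M.obj γ) : Hom.app (𝟙 M) γ m = m := rfl

@[simp] theorem comp_app (f : M ⟶ N) (g : N ⟶ P) (γ : G) (m : M.obj γ) :
    (f ≫ g).app γ m = g.app γ (f.app γ m) := rfl

instance : Zero (M ⟶ N) := ⟨{ app := fun _ => 0, map_act := fun _ _ _ => by simp }⟩
instance : Add (M ⟶ N) :=
  ⟨fun f g => { app := fun γ => f.app γ + g.app γ
                map_act := fun _ _ _ => by simp [f.map_act, g.map_act] }⟩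
instance : Neg (M ⟶ N) :=
  ⟨fun f => { app := fun γ => - f.app γ, map_act := fun _ _ _ => by simp [f.map_act] }⟩

@[simp] theorem zero_app (γ : G) (m : M.obj γ) : (0 : M ⟶ N).app γ m = 0 := rfl
@[simp] theorem add_app (f g : M ⟶ N) (γ : G) (m : M.obj γ) :
    (f + g).app γ m = f.app γ m + g.app γ m := rfl
@[simp] theorem neg_app (f : M ⟶ N) (γ : G) (m : M.obj γ) : (-f).app γ m = - f.app γ m := rfl

instance : AddCommGroup (M ⟶ N) where
  add_assoc f g h := by ext; simp [add_assoc]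
  zero_add f := by ext; simp
  add_zero f := by ext; simp
  add_comm f g := by ext; simp [add_comm]
  neg_add_cancel f := by ext; simp
  nsmul := nsmulRec
  zsmul := zsmulRec

instance : Preadditive (GrMod.{w, v, u, k} 𝒜) where
  add_comp _ _ _ f f' g := by ext; simp
  comp_add _ _ _ f g g' := by ext; simp

/-- The graded submodule `ker f`. -/
def ker (f : M ⟶ N) : GrMod.{w, v, u, k} 𝒜 where
  obj γ := (f.app γ).ker
  act h :=
    { toFun := fun a =>
        { toFun := fun m => ⟨M.act h a m.1, by
            have := m.2
            rw [AddMonoidHom.mem_ker] at this ⊢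
            rw [f.map_act, this, map_zero]⟩
          map_zero' := by ext; simp
          map_add' := fun _ _ => by ext; simp }
      map_zero' := by ext; simp
      map_add' := fun _ _ => by ext; simp }
  one_act h m := Subtype.ext (M.one_act h m.1)
  mul_act h₁ h₂ h a b m := Subtype.ext (M.mul_act h₁ h₂ h a b m.1)

/-- The inclusion of the kernel. -/
def kerι (f : M ⟶ N) : ker f ⟶ M where
  app γ := (f.app γ).ker.subtype
  map_act _ _ _ := rfl

theorem kerι_comp (f : M ⟶ N) : kerι f ≫ f = 0 := by
  ext γ m
  exact m.2

theorem app_mem_ker {f : M ⟶ N} {g : P ⟶ M} (w : g ≫ f = 0) (γ : G) (m : P.obj γ) :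
    g.app γ m ∈ (f.app γ).ker :=
  congrArg (fun t : P ⟶ N => t.app γ m) w

/-- The lift to the kernel. -/
def kerLift (f : M ⟶ N) (g : P ⟶ M) (w : g ≫ f = 0) : P ⟶ ker f where
  app γ := (g.app γ).codRestrict _ (app_mem_ker w γ)
  map_act h a m := Subtype.ext (g.map_act h a m)

/-- `ker f` is a kernel of `f`. -/
def kerIsLimit (f : M ⟶ N) : IsLimit (KernelFork.ofι (kerι f) (kerι_comp f)) :=
  KernelFork.IsLimit.ofι _ _ (fun g w => kerLift f g w) (fun _ _ => rfl)
    (fun g w m hm => by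
      ext γ x
      exact Subtype.ext (congrArg (fun t => Hom.app t γ x) hm))

instance : HasKernels (GrMod.{w, v, u, k} 𝒜) := ⟨fun f => ⟨⟨⟨_, kerIsLimit f⟩⟩⟩⟩

/-- The graded quotient module `N / f(M)`. -/
def coker (f : M ⟶ N) : GrMod.{w, v, u, k} 𝒜 where
  obj γ := N.obj γ ⧸ (f.app γ).range
  act h :=
    { toFun := fun a => QuotientAddGroup.map _ _ (N.act h a) (by
        rintro _ ⟨m, rfl⟩
        exact ⟨M.act h a m, f.map_act h a m⟩)
      map_zero' := by ext; simp
      map_add' := fun _ _ => by ext; simp }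
  one_act h m := by
    induction m using QuotientAddGroup.induction_on with
    | H m => exact congrArg _ (N.one_act h m)
  mul_act h₁ h₂ h a b m := by
    induction m using QuotientAddGroup.induction_on with
    | H m => exact congrArg _ (N.mul_act h₁ h₂ h a b m)

/-- The projection onto the cokernel. -/
def cokerπ (f : M ⟶ N) : N ⟶ coker f where
  app _ := QuotientAddGroup.mk' _
  map_act _ _ _ := rfl

theorem comp_cokerπ (f : M ⟶ N) : f ≫ cokerπ f = 0 := by
  ext γ m
  exact (QuotientAddGroup.eq_zero_iff _).2 ⟨m, rfl⟩

theorem range_le_ker {f : M ⟶ N} {g : N ⟶ P} (w : f ≫ g = 0) (γ : G) :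
    (f.app γ).range ≤ (g.app γ).ker := by
  rintro _ ⟨m, rfl⟩
  exact congrArg (fun t : M ⟶ P => t.app γ m) w

/-- The descent from the cokernel. -/
def cokerDesc (f : M ⟶ N) (g : N ⟶ P) (w : f ≫ g = 0) : coker f ⟶ P where
  app γ := QuotientAddGroup.lift _ (g.app γ) (range_le_ker w γ)
  map_act h a m := by
    induction m using QuotientAddGroup.induction_on with
    | H m => exact g.map_act h a m

/-- `coker f` is a cokernel of `f`. -/
def cokerIsColimit (f : M ⟶ N) : IsColimit (CokernelCofork.ofπ (cokerπ f) (comp_cokerπ f)) :=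
  CokernelCofork.IsColimit.ofπ _ _ (fun g w => cokerDesc f g w) (fun _ _ => rfl)
    (fun g w m hm => by
      ext γ x
      induction x using QuotientAddGroup.induction_on with
      | H x => exact congrArg (fun t => Hom.app t γ x) hm)

instance : HasCokernels (GrMod.{w, v, u, k} 𝒜) := ⟨fun f => ⟨⟨⟨_, cokerIsColimit f⟩⟩⟩⟩

theorem app_injective (f : M ⟶ N) [Mono f] (γ : G) : Function.Injective (f.app γ) := by
  rw [injective_iff_map_eq_zero]
  intro m hm
  have h : kerι f = 0 := (cancel_mono f).1 (by rw [kerι_comp, zero_comp])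
  exact congrArg (fun t : ker f ⟶ M => t.app γ ⟨m, hm⟩) h

theorem app_surjective (f : M ⟶ N) [Epi f] (γ : G) : Function.Surjective (f.app γ) := by
  intro n
  have h : cokerπ f = 0 := (cancel_epi f).1 (by rw [comp_cokerπ, comp_zero])
  exact (QuotientAddGroup.eq_zero_iff _).1 (congrArg (fun t : N ⟶ coker f => t.app γ n) h)

/-- The inverse of a bijective morphism. -/
noncomputable def invOfBijective (f : M ⟶ N) (h : ∀ γ, Function.Bijective (f.app γ)) : N ⟶ M where
  app γ := (AddEquiv.ofBijective (f.app γ) (h γ)).symm.toAddMonoidHom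
  map_act {α β γ} hh a n := by
    apply (h γ).1
    obtain ⟨m, rfl⟩ := (h β).2 n
    rw [← f.map_act]
    have e : ∀ δ x, f.app δ ((AddEquiv.ofBijective (f.app δ) (h δ)).symm x) = x :=
      fun δ x => (AddEquiv.ofBijective (f.app δ) (h δ)).apply_symm_apply x
    have e' : ∀ δ x, (AddEquiv.ofBijective (f.app δ) (h δ)).symm (f.app δ x) = x :=
      fun δ x => (AddEquiv.ofBijective (f.app δ) (h δ)).symm_apply_apply x
    simp [f.map_act, e, e']

theorem isIso_of_bijective (f : M ⟶ N) (h : ∀ γ, Function.Bijective (f.app γ)) : IsIso f :=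
  ⟨invOfBijective f h,
    by ext γ m; exact (AddEquiv.ofBijective (f.app γ) (h γ)).symm_apply_apply m,
    by ext γ m; exact (AddEquiv.ofBijective (f.app γ) (h γ)).apply_symm_apply m⟩

instance : IsNormalMonoCategory (GrMod.{w, v, u, k} 𝒜) where
  normalMonoOfMono f _ := by
    have : IsIso (kerLift (cokerπ f) f (comp_cokerπ f)) := by
      refine isIso_of_bijective _ fun γ => ⟨fun a b hab => ?_, fun b => ?_⟩
      · exact app_injective f γ (congrArg Subtype.val hab)
      · obtain ⟨m, hm⟩ := (QuotientAddGroup.eq_zero_iff _).1 b.2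
        exact ⟨m, Subtype.ext hm⟩
    exact ⟨{ Z := coker f, g := cokerπ f, w := comp_cokerπ f
             isLimit := IsLimit.ofIsoLimit (kerIsLimit (cokerπ f))
              (Fork.ext (asIso (kerLift (cokerπ f) f (comp_cokerπ f))) rfl).symm }⟩

instance : IsNormalEpiCategory (GrMod.{w, v, u, k} 𝒜) where
  normalEpiOfEpi f _ := by
    have : IsIso (cokerDesc (kerι f) f (kerι_comp f)) := by
      refine isIso_of_bijective _ fun γ => ⟨?_, fun b => ?_⟩
      · rw [injective_iff_map_eq_zero]
        intro x
        induction x using QuotientAddGroup.induction_on with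
        | H x => exact fun hx => (QuotientAddGroup.eq_zero_iff _).2 ⟨⟨x, hx⟩, rfl⟩
      · obtain ⟨m, hm⟩ := app_surjective f γ b
        exact ⟨(cokerπ (kerι f)).app γ m, hm⟩
    exact ⟨{ W := ker f, g := kerι f, w := kerι_comp f
             isColimit := IsColimit.ofIsoColimit (cokerIsColimit (kerι f))
              (Cofork.ext (asIso (cokerDesc (kerι f) f (kerι_comp f))) rfl) }⟩

/-- The zero module. -/
def zeroMod (𝒜 : Grading K G A) [SetLike.GradedMonoid 𝒜] : GrMod.{w, v, u, k} 𝒜 where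
  obj _ := PUnit
  act _ := 0
  one_act _ _ := rfl
  mul_act _ _ _ _ _ _ := rfl

instance : HasZeroObject (GrMod.{w, v, u, k} 𝒜) :=
  ⟨zeroMod 𝒜, (IsZero.iff_id_eq_zero _).2 rfl⟩

/-- The direct sum of two graded modules. -/
def prod (M N : GrMod.{w, v, u, k} 𝒜) : GrMod.{w, v, u, k} 𝒜 where
  obj γ := M.obj γ × N.obj γ
  act h :=
    { toFun := fun a => (M.act h a).prodMap (N.act h a)
      map_zero' := by ext <;> simp
      map_add' := fun _ _ => by ext <;> simp }
  one_act h m := Prod.ext (M.one_act h m.1) (N.one_act h m.2)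
  mul_act h₁ h₂ h a b m := Prod.ext (M.mul_act h₁ h₂ h a b m.1) (N.mul_act h₁ h₂ h a b m.2)

/-- The direct sum of two graded modules is a biproduct. -/
def prodBicone (M N : GrMod.{w, v, u, k} 𝒜) : BinaryBicone M N where
  pt := prod M N
  fst := { app := fun _ => AddMonoidHom.fst _ _, map_act := fun _ _ _ => rfl }
  snd := { app := fun _ => AddMonoidHom.snd _ _, map_act := fun _ _ _ => rfl }
  inl := { app := fun _ => AddMonoidHom.inl _ _
           map_act := fun h a _ => Prod.ext rfl (map_zero (N.act h a)).symm }
  inr := { app := fun _ => AddMonoidHom.inr _ _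
           map_act := fun h a _ => Prod.ext (map_zero (M.act h a)).symm rfl }
  inl_fst := rfl
  inl_snd := rfl
  inr_fst := rfl
  inr_snd := rfl

instance : HasBinaryBiproducts (GrMod.{w, v, u, k} 𝒜) :=
  ⟨fun M N => HasBinaryBiproduct.mk ⟨prodBicone M N, isBinaryBilimitOfTotal (prodBicone M N) (by
    ext γ m
    exact Prod.ext (add_zero _) (zero_add _))⟩⟩

instance : HasFiniteProducts (GrMod.{w, v, u, k} 𝒜) :=
  hasFiniteProducts_of_has_binary_and_terminal

/-- The category `Mod^G A` is abelian. -/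
noncomputable instance : Abelian (GrMod.{w, v, u, k} 𝒜) where

/-- The shift `Σ_γ M = M(γ)`, with `M(γ)_γ' = M_(γ + γ')`. -/
def shift (γ : G) (M : GrMod.{w, v, u, k} 𝒜) : GrMod.{w, v, u, k} 𝒜 where
  obj γ' := M.obj (γ + γ')
  act {α β δ} h := M.act (by rw [← h]; abel : α + (γ + β) = γ + δ)
  one_act _ m := M.one_act _ m
  mul_act _ _ _ a b m := M.mul_act _ _ _ a b m

/-- An isomorphism of graded modules, whose pieces may live in different universes. -/
structure Equiv (M : GrMod.{w, v, u, k} 𝒜) (N : GrMod.{w, v', u, k} 𝒜) where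
  /-- the components -/
  app : ∀ γ, M.obj γ ≃+ N.obj γ
  map_act : ∀ {α β γ : G} (h : α + β = γ) (a : 𝒜 α) (m : M.obj β),
    app γ (M.act h a m) = N.act h a (app β m)

/-- A graded module is zero if all its homogeneous pieces are. -/
def IsZeroModule (M : GrMod.{w, v, u, k} 𝒜) : Prop := ∀ γ, Subsingleton (M.obj γ)

/-- `A` as a graded left `A`-module. -/
def regular (𝒜 : Grading K G A) [SetLike.GradedMonoid 𝒜] : GrMod.{w, u, u, k} 𝒜 where
  obj γ := 𝒜 γ
  act h :=
    { toFun := fun a =>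
        { toFun := fun b => ⟨a * b, h ▸ SetLike.GradedMul.mul_mem a.2 b.2⟩
          map_zero' := by ext; simp
          map_add' := fun _ _ => by ext; simp [mul_add] }
      map_zero' := by ext; simp
      map_add' := fun _ _ => by ext; simp [add_mul] }
  one_act _ m := Subtype.ext (one_mul _)
  mul_act _ _ _ a b m := Subtype.ext (mul_assoc _ _ _)

/-- Right multiplication by `b ∈ A_α`, a morphism of graded left modules
`Σ_β A ⟶ Σ_(α + β) A`. -/
def rightMul (𝒜 : Grading K G A) [SetLike.GradedMonoid 𝒜] {α β γ : G} (h : α + β = γ)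
    (b : 𝒜 α) : shift β (regular 𝒜) ⟶ shift γ (regular 𝒜) where
  app δ :=
    { toFun := fun x => ⟨x.1 * b.1, by
        have := SetLike.GradedMul.mul_mem x.2 b.2
        rwa [show β + δ + α = γ + δ by rw [← h]; abel] at this⟩
      map_zero' := Subtype.ext (zero_mul _)
      map_add' := fun _ _ => Subtype.ext (add_mul _ _ _) }
  map_act h a m := Subtype.ext (mul_assoc _ _ _)

/-- Restriction of scalars along a degree preserving homomorphism of algebras. -/
def restrict {B : Type*} [Ring B] [Algebra K B] {ℬ : Grading K G B} [SetLike.GradedMonoid ℬ]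
    (f : A →ₐ[K] B) (hf : ∀ γ a, a ∈ 𝒜 γ → f a ∈ ℬ γ) (M : GrMod ℬ) : GrMod 𝒜 where
  obj := M.obj
  act h :=
    { toFun := fun a => M.act h ⟨f a, hf _ _ a.2⟩
      map_zero' := by
        rw [← map_zero (M.act h)]; congr 1; ext; simp
      map_add' := fun a b => by
        rw [← map_add]; congr 1; ext; simp }
  one_act h m := by
    refine Eq.trans ?_ (M.one_act h m)
    congr 2; ext; simp
  mul_act h₁ h₂ h a b m := by
    refine Eq.trans ?_ (M.mul_act h₁ h₂ h _ _ m)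
    congr 2; ext; simp

end GrMod

end GradedModules

section Enveloping

variable {K : Type k} {G : Type w} {A : Type u} [Field K] [AddCommGroup G] [Ring A] [Algebra K A]

set_option linter.unusedSectionVars false

/-- The grading of the opposite algebra. -/
def opGrading (𝒜 : Grading K G A) : Grading K G Aᵐᵒᵖ := fun γ =>
  (𝒜 γ).map (MulOpposite.opLinearEquiv K).toLinearMap

theorem mem_opGrading {𝒜 : Grading K G A} {γ : G} {x : Aᵐᵒᵖ} :
    x ∈ opGrading 𝒜 γ ↔ x.unop ∈ 𝒜 γ :=
  ⟨by rintro ⟨a, ha, rfl⟩; exact ha, fun h => ⟨x.unop, h, rfl⟩⟩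

instance (𝒜 : Grading K G A) [SetLike.GradedMonoid 𝒜] :
    SetLike.GradedMonoid (opGrading 𝒜) where
  one_mem := mem_opGrading.2 SetLike.GradedOne.one_mem
  mul_mem α β x y hx hy := by
    rw [mem_opGrading] at *
    rw [add_comm α β]
    exact SetLike.GradedMul.mul_mem hy hx

variable {B : Type*} [Ring B] [Algebra K B]

/-- The grading of a tensor product:
`(A ⊗ B)_γ` is the sum of the subspaces `A_α ⊗ B_β` with `α + β = γ`. -/
def tensorGrading (𝒜 : Grading K G A) (ℬ : Grading K G B) : Grading K G (A ⊗[K] B) := fun γ =>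
  Submodule.span K {x | ∃ α β, α + β = γ ∧ ∃ a ∈ 𝒜 α, ∃ b ∈ ℬ β, x = a ⊗ₜ[K] b}

theorem tmul_mem {𝒜 : Grading K G A} {ℬ : Grading K G B} {α β γ : G} (h : α + β = γ)
    {a : A} (ha : a ∈ 𝒜 α) {b : B} (hb : b ∈ ℬ β) : a ⊗ₜ[K] b ∈ tensorGrading 𝒜 ℬ γ :=
  Submodule.subset_span ⟨α, β, h, a, ha, b, hb, rfl⟩

instance (𝒜 : Grading K G A) [SetLike.GradedMonoid 𝒜] (ℬ : Grading K G B)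
    [SetLike.GradedMonoid ℬ] : SetLike.GradedMonoid (tensorGrading 𝒜 ℬ) where
  one_mem := tmul_mem (zero_add 0) SetLike.GradedOne.one_mem SetLike.GradedOne.one_mem
  mul_mem γ δ x y hx hy := by
    induction hx using Submodule.span_induction with
    | zero => simp
    | add x x' _ _ h h' => rw [add_mul]; exact add_mem h h'
    | smul c x _ h => rw [smul_mul_assoc]; exact Submodule.smul_mem _ _ h
    | mem x hx =>
      obtain ⟨α, β, rfl, a, ha, b, hb, rfl⟩ := hx
      induction hy using Submodule.span_induction with
      | zero => simp
      | add y y' _ _ h h' => rw [mul_add]; exact add_mem h h'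
      | smul c y _ h => rw [mul_smul_comm]; exact Submodule.smul_mem _ _ h
      | mem y hy =>
        obtain ⟨α', β', rfl, a', ha', b', hb', rfl⟩ := hy
        rw [Algebra.TensorProduct.tmul_mul_tmul]
        exact tmul_mem (add_add_add_comm _ _ _ _) (SetLike.GradedMul.mul_mem ha ha')
          (SetLike.GradedMul.mul_mem hb hb')

/-- The grading of the enveloping algebra `A^e = A ⊗ A^o`. Graded left `A^e`-modules are
`G`-graded `A`-bimodules, with `a ⊗ b^o` acting as `m ↦ a m b`. -/
abbrev envGrading (𝒜 : Grading K G A) : Grading K G (A ⊗[K] Aᵐᵒᵖ) :=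
  tensorGrading 𝒜 (opGrading 𝒜)

theorem mulLeftRight_mem {𝒜 : Grading K G A} [SetLike.GradedMonoid 𝒜] {α β γ : G}
    (h : α + β = γ) {s : A ⊗[K] Aᵐᵒᵖ} (hs : s ∈ envGrading 𝒜 α) {m : A} (hm : m ∈ 𝒜 β) :
    AlgHom.mulLeftRight K A s m ∈ 𝒜 γ := by
  induction hs using Submodule.span_induction with
  | zero => simp
  | add x y _ _ hx hy => rw [map_add, LinearMap.add_apply]; exact add_mem hx hy
  | smul c x _ hx => rw [map_smul, LinearMap.smul_apply]; exact Submodule.smul_mem _ _ hx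
  | mem x hx =>
    obtain ⟨α', β', rfl, a, ha, b, hb, rfl⟩ := hx
    rw [AlgHom.mulLeftRight_apply]
    have := SetLike.GradedMul.mul_mem (SetLike.GradedMul.mul_mem ha hm) (mem_opGrading.1 hb)
    rwa [show α' + β + β' = γ by rw [← h]; abel] at this

/-- `A` as a graded `A`-bimodule, i.e. as a graded left `A^e`-module, `a ⊗ b^o` acting as
`m ↦ a m b`. -/
noncomputable def bimod (𝒜 : Grading K G A) [SetLike.GradedMonoid 𝒜] :
    GrMod.{w, u, u, k} (envGrading 𝒜) where
  obj γ := 𝒜 γ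
  act h :=
    { toFun := fun s =>
        { toFun := fun m => ⟨AlgHom.mulLeftRight K A s.1 m.1, mulLeftRight_mem h s.2 m.2⟩
          map_zero' := by ext; simp
          map_add' := fun _ _ => by ext; simp }
      map_zero' := by ext; simp
      map_add' := fun _ _ => by ext; simp }
  one_act _ m := Subtype.ext (by simp)
  mul_act _ _ _ a b m := Subtype.ext (by simp)

/-- The group `Aut_G(A)` of degree preserving algebra automorphisms. -/
def gradedAut (𝒜 : Grading K G A) : Subgroup (A ≃ₐ[K] A) where
  carrier := {σ | ∀ γ a, σ a ∈ 𝒜 γ ↔ a ∈ 𝒜 γ}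
  one_mem' _ _ := Iff.rfl
  mul_mem' {σ τ} hσ hτ γ a := (hσ γ (τ a)).trans (hτ γ a)
  inv_mem' {σ} hσ γ a := by
    rw [← hσ γ (σ⁻¹ a)]
    exact iff_of_eq (congrArg (· ∈ 𝒜 γ) (σ.apply_symm_apply a).symm).symm

/-- The endomorphism `μ ⊗ ν^o` of `A^e`. -/
noncomputable def envMap (μ ν : A ≃ₐ[K] A) : A ⊗[K] Aᵐᵒᵖ →ₐ[K] A ⊗[K] Aᵐᵒᵖ :=
  Algebra.TensorProduct.map μ.toAlgHom (AlgHom.op ν.toAlgHom)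

theorem envMap_mem {𝒜 : Grading K G A} (μ ν : gradedAut 𝒜) (γ : G) (s : A ⊗[K] Aᵐᵒᵖ)
    (hs : s ∈ envGrading 𝒜 γ) : envMap μ.1 ν.1 s ∈ envGrading 𝒜 γ := by
  induction hs using Submodule.span_induction with
  | zero => simp
  | add x y _ _ hx hy => rw [map_add]; exact add_mem hx hy
  | smul c x _ hx => rw [map_smul]; exact Submodule.smul_mem _ _ hx
  | mem x hx =>
    obtain ⟨α, β, rfl, a, ha, b, hb, rfl⟩ := hx
    exact tmul_mem rfl ((μ.2 _ _).2 ha) (mem_opGrading.2 ((ν.2 _ _).2 (mem_opGrading.1 hb)))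

/-- The twisted bimodule `^μ M ^ν`: same pieces as `M`, with `a * m * b = μ(a) m ν(b)`. -/
noncomputable def twist {𝒜 : Grading K G A} [SetLike.GradedMonoid 𝒜] (μ ν : gradedAut 𝒜)
    (M : GrMod.{w, v, u, k} (envGrading 𝒜)) : GrMod.{w, v, u, k} (envGrading 𝒜) :=
  GrMod.restrict (envMap μ.1 ν.1) (envMap_mem μ ν) M

/-- The anti-automorphism `a ⊗ b^o ↦ b ⊗ a^o` of `A^e`. It identifies right `A^e`-modules with
left `A^e`-modules. -/
noncomputable def envSwap (K : Type k) (A : Type u) [Field K] [Ring A] [Algebra K A] :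
    A ⊗[K] Aᵐᵒᵖ →ₗ[K] A ⊗[K] Aᵐᵒᵖ :=
  (TensorProduct.map (MulOpposite.opLinearEquiv K).symm.toLinearMap
    (MulOpposite.opLinearEquiv K).toLinearMap).comp (TensorProduct.comm K A Aᵐᵒᵖ).toLinearMap

@[simp] theorem envSwap_tmul (a : A) (b : Aᵐᵒᵖ) :
    envSwap K A (a ⊗ₜ b) = b.unop ⊗ₜ MulOpposite.op a := rfl

theorem envSwap_one : envSwap K A 1 = 1 := rfl

theorem envSwap_mul (s t : A ⊗[K] Aᵐᵒᵖ) :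
    envSwap K A (s * t) = envSwap K A t * envSwap K A s := by
  induction s using TensorProduct.induction_on with
  | zero => simp
  | add x y hx hy => rw [add_mul, map_add, hx, hy, map_add, mul_add]
  | tmul a b =>
    induction t using TensorProduct.induction_on with
    | zero => simp
    | add x y hx hy => rw [mul_add, map_add, hx, hy, map_add, add_mul]
    | tmul a' b' => simp

theorem envSwap_mem {𝒜 : Grading K G A} {γ : G} {s : A ⊗[K] Aᵐᵒᵖ}
    (hs : s ∈ envGrading 𝒜 γ) : envSwap K A s ∈ envGrading 𝒜 γ := by
  induction hs using Submodule.span_induction with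
  | zero => simp
  | add x y _ _ hx hy => rw [map_add]; exact add_mem hx hy
  | smul c x _ hx => rw [map_smul]; exact Submodule.smul_mem _ _ hx
  | mem x hx =>
    obtain ⟨α, β, rfl, a, ha, b, hb, rfl⟩ := hx
    exact tmul_mem (add_comm β α) (mem_opGrading.1 hb) (mem_opGrading.2 ha)

end Enveloping

section Ext

variable {K : Type k} {G A : Type u} [Field K] [AddCommGroup G] [Ring A] [Algebra K A]

/-- The groups `Ext^i` in `Mod^G A` are formed in a universe in which the derived category of
`Mod^G A` exists. -/
instance hasExt (𝒜 : Grading K G A) [SetLike.GradedMonoid 𝒜] :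
    HasExt.{u + 1} (GrMod.{u, u, u, k} 𝒜) :=
  HasExt.standard _

/-- The map `Ext^i_{Mod^G A}(M, Σ_β A) → Ext^i_{Mod^G A}(M, Σ_γ A)` induced by the right
multiplication of `A` by `b ∈ A_α`, where `α + β = γ`. -/
noncomputable def extRightMul (𝒜 : Grading K G A) [SetLike.GradedMonoid 𝒜]
    (M : GrMod.{u, u, u, k} 𝒜) (i : ℕ) {α β γ : G} (h : α + β = γ) (b : 𝒜 α) :
    Abelian.Ext.{u + 1} M (GrMod.shift β (GrMod.regular 𝒜)) i →+
      Abelian.Ext.{u + 1} M (GrMod.shift γ (GrMod.regular 𝒜)) i :=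
  (Abelian.Ext.mk₀ (GrMod.rightMul 𝒜 h b)).postcomp M (add_zero i)

theorem extRightMul_zero (𝒜 : Grading K G A) [SetLike.GradedMonoid 𝒜]
    (M : GrMod.{u, u, u, k} 𝒜) (i : ℕ) {α β γ : G} (h : α + β = γ) :
    extRightMul 𝒜 M i h 0 = 0 := by
  have e : GrMod.rightMul 𝒜 h 0 = 0 := by
    ext δ m
    exact Subtype.ext (mul_zero _)
  ext x
  simp [extRightMul, e]

theorem extRightMul_add (𝒜 : Grading K G A) [SetLike.GradedMonoid 𝒜]
    (M : GrMod.{u, u, u, k} 𝒜) (i : ℕ) {α β γ : G} (h : α + β = γ) (b c : 𝒜 α) :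
    extRightMul 𝒜 M i h (b + c) = extRightMul 𝒜 M i h b + extRightMul 𝒜 M i h c := by
  have e : GrMod.rightMul 𝒜 h (b + c) = GrMod.rightMul 𝒜 h b + GrMod.rightMul 𝒜 h c := by
    ext δ m
    exact Subtype.ext (mul_add _ _ _)
  ext x
  simp [extRightMul, e, Abelian.Ext.mk₀_add]

theorem extRightMul_one (𝒜 : Grading K G A) [SetLike.GradedMonoid 𝒜]
    (M : GrMod.{u, u, u, k} 𝒜) (i : ℕ) {γ : G} (h : 0 + γ = γ) (b : 𝒜 0) (hb : b.1 = 1)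
    (x : Abelian.Ext.{u + 1} M (GrMod.shift γ (GrMod.regular 𝒜)) i) :
    extRightMul 𝒜 M i h b x = x := by
  have e : GrMod.rightMul 𝒜 h b = 𝟙 _ := by
    ext δ m
    exact Subtype.ext ((congrArg (m.1 * ·) hb).trans (mul_one _))
  simp [extRightMul, e]

theorem extRightMul_mul (𝒜 : Grading K G A) [SetLike.GradedMonoid 𝒜]
    (M : GrMod.{u, u, u, k} 𝒜) (i : ℕ) {α β γ δ ζ : G} (h₁ : β + γ = δ) (h₂ : α + δ = ζ)
    (h : (α + β) + γ = ζ) (a : 𝒜 α) (b : 𝒜 β) (c : 𝒜 (α + β)) (hc : c.1 = b.1 * a.1)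
    (x : Abelian.Ext.{u + 1} M (GrMod.shift γ (GrMod.regular 𝒜)) i) :
    extRightMul 𝒜 M i h c x = extRightMul 𝒜 M i h₂ a (extRightMul 𝒜 M i h₁ b x) := by
  have e : GrMod.rightMul 𝒜 h c = GrMod.rightMul 𝒜 h₁ b ≫ GrMod.rightMul 𝒜 h₂ a := by
    ext δ m
    exact Subtype.ext ((congrArg (m.1 * ·) hc).trans (mul_assoc _ _ _).symm)
  simp [extRightMul, e, ← Abelian.Ext.mk₀_comp_mk₀]

/-- The graded `A`-bimodule `Ext^{i,G}_{A^e}(A, A^e) = ⨁_γ Ext^i_{Mod^G A^e}(A, Σ_γ A^e)`. The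
bimodule structure comes from the right multiplications of `A^e`: an element `a ⊗ b^o` acts as the
map induced by right multiplication with `b ⊗ a^o`, so that `a * ξ * b = ξ · (b ⊗ a^o)`. -/
noncomputable def extBimod (𝒜 : Grading K G A) [SetLike.GradedMonoid 𝒜] (i : ℕ) :
    GrMod.{u, u + 1, u, k} (envGrading 𝒜) where
  obj γ := Abelian.Ext.{u + 1} (bimod 𝒜) (GrMod.shift γ (GrMod.regular (envGrading 𝒜))) i
  act h :=
    { toFun := fun s =>
        extRightMul (envGrading 𝒜) (bimod 𝒜) i h ⟨envSwap K A s, envSwap_mem s.2⟩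
      map_zero' := (congrArg (extRightMul _ _ i h) (Subtype.ext (map_zero (envSwap K A)))).trans
        (extRightMul_zero _ _ i h)
      map_add' := fun s t =>
        (congrArg (extRightMul _ _ i h) (Subtype.ext (map_add (envSwap K A) s.1 t.1))).trans
          (extRightMul_add _ _ i h ⟨_, envSwap_mem s.2⟩ ⟨_, envSwap_mem t.2⟩) }
  one_act h x := extRightMul_one _ _ i h _ envSwap_one x
  mul_act h₁ h₂ h _ _ x := extRightMul_mul _ _ i h₁ h₂ h _ _ _ (envSwap_mul _ _) x

end Ext

section Quotient

variable {K : Type k} {G : Type w} {A : Type u} [Field K] [AddCommGroup G] [Ring A] [Algebra K A]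

/-- `z` is normal: `zA = Az`. -/
def IsNormalElement (z : A) : Prop :=
  Set.range (fun a : A => z * a) = Set.range (fun a : A => a * z)

/-- The quotient algebra of `A` by the two-sided ideal generated by `z`;
this ideal is `zA` when `z` is normal. -/
abbrev QuotAlg (z : A) : Type u := (TwoSidedIdeal.span {z}).ringCon.Quotient

/-- The projection `A → A / (z)`. -/
def quotMk (K : Type k) {A : Type u} [Field K] [Ring A] [Algebra K A] (z : A) :
    A →ₐ[K] QuotAlg z :=
  RingCon.mkₐ K (TwoSidedIdeal.span {z}).ringCon

/-- The grading of `A / (z)`, for homogeneous `z`: its pieces are the images of those of `A`. -/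
def quotGrading (𝒜 : Grading K G A) (z : A) : Grading K G (QuotAlg z) := fun γ =>
  (𝒜 γ).map (quotMk K z).toLinearMap

instance (𝒜 : Grading K G A) [SetLike.GradedMonoid 𝒜] (z : A) :
    SetLike.GradedMonoid (quotGrading 𝒜 z) where
  one_mem := ⟨1, SetLike.GradedOne.one_mem, map_one (quotMk K z)⟩
  mul_mem := by
    rintro α β _ _ ⟨a, ha, rfl⟩ ⟨b, hb, rfl⟩
    exact ⟨a * b, SetLike.GradedMul.mul_mem ha hb, map_mul (quotMk K z) a b⟩

/-- `σ'` is the automorphism of `A / (z)` induced by the automorphism `σ` of `A`. -/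
def IsInduced {𝒜 : Grading K G A} {z : A} (σ : gradedAut 𝒜)
    (σ' : gradedAut (quotGrading 𝒜 z)) : Prop :=
  ∀ a : A, σ'.1 (quotMk K z a) = quotMk K z (σ.1 a)

end Quotient

end SkewCY

namespace SkewCY

section ExtChange

open Abelian

universe w₁ v₁ u₁ w₂ v₂ u₂

variable {𝒞 : Type u₁} [Category.{v₁} 𝒞] [Abelian 𝒞] [HasExt.{w₁} 𝒞]
variable {𝒟 : Type u₂} [Category.{v₂} 𝒟] [Abelian 𝒟] [HasExt.{w₂} 𝒟]
variable (F : 𝒟 ⥤ 𝒞) [F.Additive] [PreservesFiniteLimits F] [PreservesFiniteColimits F]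

/-- Apply an exact functor to an extension, then compose with a morphism on the left and an
extension on the right. -/
noncomputable def extChange {X' N' : 𝒞} {X N : 𝒟} (η : X' ⟶ F.obj X) {j : ℕ}
    (c : Ext.{w₁} (F.obj N) N' j) {n m : ℕ} (h : n + j = m) :
    Ext.{w₂} X N n →+ Ext.{w₁} X' N' m :=
  ((c.postcomp X' h).comp ((Ext.mk₀ η).precomp (F.obj N) (zero_add n))).comp
    (F.mapExtAddHom X N n)

theorem extChange_apply {X' N' : 𝒞} {X N : 𝒟} (η : X' ⟶ F.obj X) {j : ℕ}
    (c : Ext.{w₁} (F.obj N) N' j) {n m : ℕ} (h : n + j = m) (x : Ext.{w₂} X N n) :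
    extChange F η c h x =
      ((Ext.mk₀ η).comp (x.mapExactFunctor F) (zero_add n)).comp c h := rfl

theorem extChange_mk₀_comp {X' Y' N' : 𝒞} {X Y N : 𝒟} (η : X' ⟶ F.obj X) (θ : Y' ⟶ F.obj Y)
    (f' : X' ⟶ Y') (f : X ⟶ Y) (w : f' ≫ θ = η ≫ F.map f) {j : ℕ}
    (c : Ext.{w₁} (F.obj N) N' j) {n m : ℕ} (h : n + j = m) (x : Ext.{w₂} Y N n) :
    extChange F η c h ((Ext.mk₀ f).comp x (zero_add n)) =
      (Ext.mk₀ f').comp (extChange F θ c h x) (zero_add m) := by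
  rw [extChange_apply, extChange_apply, Ext.mapExactFunctor_comp, Ext.mapExactFunctor_mk₀,
    Ext.mk₀_comp_mk₀_assoc, ← w, ← Ext.mk₀_comp_mk₀_assoc, Ext.comp_assoc]
  lia

theorem extChange_comp_mk₀ {X' N₁' N₂' : 𝒞} {X N₁ N₂ : 𝒟} (η : X' ⟶ F.obj X) {j : ℕ}
    (c₁ : Ext.{w₁} (F.obj N₁) N₁' j) (c₂ : Ext.{w₁} (F.obj N₂) N₂' j)
    (g : N₁ ⟶ N₂) (g' : N₁' ⟶ N₂')
    (w : c₁.comp (Ext.mk₀ g') (add_zero j) = (Ext.mk₀ (F.map g)).comp c₂ (zero_add j))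
    {n m : ℕ} (h : n + j = m) (x : Ext.{w₂} X N₁ n) :
    extChange F η c₂ h (x.comp (Ext.mk₀ g) (add_zero n)) =
      (extChange F η c₁ h x).comp (Ext.mk₀ g') (add_zero m) := by
  rw [extChange_apply, extChange_apply, Ext.mapExactFunctor_comp, Ext.mapExactFunctor_mk₀,
    Ext.comp_assoc_of_third_deg_zero, w, ← Ext.comp_assoc_of_third_deg_zero,
    Ext.comp_assoc_of_second_deg_zero]

theorem extChange_extClass_comp {S : ShortComplex 𝒟} (hS : S.ShortExact) {S' : ShortComplex 𝒞}
    (hS' : S'.ShortExact) (η₁ : S'.X₁ ⟶ F.obj S.X₁) (η₂ : S'.X₂ ⟶ F.obj S.X₂)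
    (η₃ : S'.X₃ ⟶ F.obj S.X₃) (w₁₂ : S'.f ≫ η₂ = η₁ ≫ F.map S.f)
    (w₂₃ : S'.g ≫ η₃ = η₂ ≫ F.map S.g) {N : 𝒟} {N' : 𝒞} {j : ℕ}
    (c : Ext.{w₁} (F.obj N) N' j) {n m : ℕ} (h : n + j = m) {n' m' : ℕ} (h' : n' + j = m')
    (hn : 1 + n = n') (hm : 1 + m = m') (x : Ext.{w₂} S.X₁ N n) :
    extChange F η₃ c h' (hS.extClass.comp x hn) = hS'.extClass.comp (extChange F η₁ c h x) hm := by
  have e : hS'.extClass.comp (Ext.mk₀ η₁) (add_zero 1) =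
      (Ext.mk₀ η₃).comp (hS.extClass.mapExactFunctor F) (zero_add 1) := by
    rw [Ext.mapExactFunctor_extClass]
    exact ShortComplex.ShortExact.extClass_naturality hS' (hS.map_of_exact F)
      { τ₁ := η₁, τ₂ := η₂, τ₃ := η₃, comm₁₂ := w₁₂.symm, comm₂₃ := w₂₃.symm }
  rw [extChange_apply, extChange_apply, Ext.mapExactFunctor_comp,
    ← Ext.comp_assoc (Ext.mk₀ η₃) _ _ (zero_add 1) hn (by lia), ← e,
    Ext.comp_assoc_of_second_deg_zero, Ext.comp_assoc]
  lia

/-- Dimension shifting for comparison maps between extension groups. -/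
theorem extChange_bijective_succ {S : ShortComplex 𝒟} (hS : S.ShortExact) {S' : ShortComplex 𝒞}
    (hS' : S'.ShortExact) (η₁ : S'.X₁ ⟶ F.obj S.X₁) (η₂ : S'.X₂ ⟶ F.obj S.X₂)
    (η₃ : S'.X₃ ⟶ F.obj S.X₃) (w₁₂ : S'.f ≫ η₂ = η₁ ≫ F.map S.f)
    (w₂₃ : S'.g ≫ η₃ = η₂ ≫ F.map S.g) {N : 𝒟} {N' : 𝒞} {j : ℕ}
    (c : Ext.{w₁} (F.obj N) N' j) {n m : ℕ} (h : n + j = m) {n' m' : ℕ} (h' : n' + j = m')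
    (hn : 1 + n = n') (hm : 1 + m = m')
    (h₁ : Function.Bijective (extChange F η₁ c h)) (h₂ : Function.Surjective (extChange F η₂ c h))
    (hP : Subsingleton (Ext.{w₂} S.X₂ N n')) (hP' : Subsingleton (Ext.{w₁} S'.X₂ N' m')) :
    Function.Bijective (extChange F η₃ c h') := by
  have key := extChange_extClass_comp F hS hS' η₁ η₂ η₃ w₁₂ w₂₃ c h h' hn hm
  constructor
  · rw [injective_iff_map_eq_zero]
    intro x hx
    obtain ⟨x₁, rfl⟩ := Ext.contravariant_sequence_exact₃ hS N x (Subsingleton.elim _ _) hn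
    rw [key] at hx
    obtain ⟨y₂, hy₂⟩ := Ext.contravariant_sequence_exact₁ hS' N' _ hm hx
    obtain ⟨x₂, rfl⟩ := h₂ y₂
    rw [← extChange_mk₀_comp F η₁ η₂ S'.f S.f w₁₂ c h] at hy₂
    rw [← h₁.1 hy₂, hS.extClass_comp_assoc]
  · intro y
    obtain ⟨y₁, rfl⟩ := Ext.contravariant_sequence_exact₃ hS' N' y (Subsingleton.elim _ _) hm
    obtain ⟨x₁, rfl⟩ := h₁.2 y₁
    exact ⟨hS.extClass.comp x₁ hn, key x₁⟩

end ExtChange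

namespace GrMod

section Exactness

variable {K : Type k} {G : Type w} {A : Type u} [Field K] [AddCommGroup G] [Ring A] [Algebra K A]
variable {𝒜 : Grading K G A} [SetLike.GradedMonoid 𝒜]
variable {M N P : GrMod.{w, v, u, k} 𝒜}

theorem mono_of_injective (f : M ⟶ N) (h : ∀ γ, Function.Injective (f.app γ)) : Mono f :=
  ⟨fun _ _ e => hom_ext fun γ m => h γ (congrArg (fun t => Hom.app t γ m) e)⟩

theorem epi_of_surjective (f : M ⟶ N) (h : ∀ γ, Function.Surjective (f.app γ)) : Epi f :=
  ⟨fun _ _ e => hom_ext fun γ n => by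
    obtain ⟨m, rfl⟩ := h γ n
    exact congrArg (fun t => Hom.app t γ m) e⟩

theorem shortExact_of_exact {S : ShortComplex (GrMod.{w, v, u, k} 𝒜)}
    (hf : ∀ γ, Function.Injective (S.f.app γ))
    (hfg : ∀ γ (m : S.X₂.obj γ), S.g.app γ m = 0 → ∃ l, S.f.app γ l = m)
    (hg : ∀ γ, Function.Surjective (S.g.app γ)) : S.ShortExact := by
  have := mono_of_injective S.f hf
  have := epi_of_surjective S.g hg
  have : IsIso (kerLift S.g S.f S.zero) := by
    refine isIso_of_bijective _ fun γ => ⟨fun a b hab => ?_, fun b => ?_⟩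
    · exact hf γ (congrArg Subtype.val hab)
    · obtain ⟨m, hm⟩ := hfg γ b.1 b.2
      exact ⟨m, Subtype.ext hm⟩
  refine ShortComplex.ShortExact.mk' (S.exact_of_f_is_kernel ?_) ‹_› ‹_›
  exact IsLimit.ofIsoLimit (kerIsLimit S.g) (Fork.ext (asIso (kerLift S.g S.f S.zero)) rfl).symm

theorem exists_of_shortExact {S : ShortComplex (GrMod.{w, v, u, k} 𝒜)} (hS : S.ShortExact)
    {γ : G} (m : S.X₂.obj γ) (hm : S.g.app γ m = 0) : ∃ l, S.f.app γ l = m := by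
  have := hS.mono_f
  refine ⟨(hS.exact.lift (kerι S.g) (kerι_comp S.g)).app γ ⟨m, hm⟩, ?_⟩
  exact congrArg (fun t : ker S.g ⟶ S.X₂ => t.app γ ⟨m, hm⟩)
    (hS.exact.lift_f (kerι S.g) (kerι_comp S.g))

end Exactness

section Restrict

variable {K : Type k} {G : Type w} {A B : Type u} [Field K] [AddCommGroup G]
variable [Ring A] [Algebra K A] [Ring B] [Algebra K B]
variable {𝒜 : Grading K G A} [SetLike.GradedMonoid 𝒜]
variable {ℬ : Grading K G B} [SetLike.GradedMonoid ℬ]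

/-- Restriction of scalars, as a functor. -/
def restrictFunctor (f : A →ₐ[K] B) (hf : ∀ γ a, a ∈ 𝒜 γ → f a ∈ ℬ γ) :
    GrMod.{w, v, u, k} ℬ ⥤ GrMod.{w, v, u, k} 𝒜 where
  obj M := restrict f hf M
  map g :=
    { app := g.app
      map_act := fun h _ m => g.map_act h _ m }

variable (f : A →ₐ[K] B) (hf : ∀ γ a, a ∈ 𝒜 γ → f a ∈ ℬ γ)

instance : (restrictFunctor.{w, v, u, k} f hf).Additive where

theorem restrictFunctor_exact :
    PreservesFiniteLimits (restrictFunctor.{w, v, u, k} f hf) ∧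
      PreservesFiniteColimits (restrictFunctor.{w, v, u, k} f hf) := by
  refine ((Functor.exact_tfae (restrictFunctor.{w, v, u, k} f hf)).out 0 3).1 fun S hS => ?_
  have := hS.mono_f
  have := hS.epi_g
  exact shortExact_of_exact (fun γ => app_injective S.f γ)
    (fun γ m hm => exists_of_shortExact hS m hm) (fun γ => app_surjective S.g γ)

instance : PreservesFiniteLimits (restrictFunctor.{w, v, u, k} f hf) :=
  (restrictFunctor_exact f hf).1

instance : PreservesFiniteColimits (restrictFunctor.{w, v, u, k} f hf) :=
  (restrictFunctor_exact f hf).2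

end Restrict

section Free

variable {K : Type k} {G : Type w} {A : Type u} [Field K] [AddCommGroup G] [Ring A] [Algebra K A]
variable (𝒜 : Grading K G A) [SetLike.GradedMonoid 𝒜]

theorem act_one_eq {M : GrMod.{w, v, u, k} 𝒜} {α γ : G} (h : α + γ = γ) (a : 𝒜 α)
    (ha : a.1 = 1) (m : M.obj γ) : M.act h a m = m := by
  obtain rfl : α = 0 := by simpa using h
  obtain rfl : a = ⟨1, SetLike.GradedOne.one_mem⟩ := Subtype.ext ha
  exact M.one_act h m

theorem act_act {M : GrMod.{w, v, u, k} 𝒜} {α β γ δ ζ η : G} (h₁ : β + γ = δ) (h₂ : α + δ = ζ)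
    (h : η + γ = ζ) (a : 𝒜 α) (b : 𝒜 β) (c : 𝒜 η) (hc : c.1 = a.1 * b.1) (m : M.obj γ) :
    M.act h₂ a (M.act h₁ b m) = M.act h c m := by
  obtain rfl : η = α + β := by
    apply add_right_cancel (b := γ)
    rw [h, ← h₂, ← h₁, add_assoc]
  obtain rfl : c = ⟨a * b, SetLike.GradedMul.mul_mem a.2 b.2⟩ := Subtype.ext hc
  exact (M.mul_act h₁ h₂ h a b m).symm

variable {X : Type v} (deg : X → G)

/-- Left multiplication on the components of a free module. -/
def mulHom {α β γ : G} (h : α + β = γ) : 𝒜 α →+ 𝒜 β →+ 𝒜 γ where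
  toFun a :=
    { toFun := fun b => ⟨a * b, h ▸ SetLike.GradedMul.mul_mem a.2 b.2⟩
      map_zero' := by ext; simp
      map_add' := fun _ _ => by ext; simp [mul_add] }
  map_zero' := by ext; simp
  map_add' := fun _ _ => by ext; simp [add_mul]

@[simp] theorem mulHom_coe {α β γ : G} (h : α + β = γ) (a : 𝒜 α) (b : 𝒜 β) :
    (mulHom 𝒜 h a b : A) = a * b := rfl

/-- The free graded module on homogeneous generators of prescribed degrees. -/
noncomputable def free : GrMod.{w, max v u, u, k} 𝒜 where
  obj γ := Π₀ x : X, 𝒜 (γ - deg x)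
  act {α β γ} h :=
    { toFun := fun a => DFinsupp.mapRange.addMonoidHom
        fun x => mulHom 𝒜 (show α + (β - deg x) = γ - deg x by rw [← h]; abel) a
      map_zero' := by ext; simp
      map_add' := fun _ _ => by ext; simp }
  one_act h m := by ext x; simp
  mul_act h₁ h₂ h a b m := by ext x; simp [mul_assoc]

variable {deg}

open Classical in
/-- The generators of the free module, with homogeneous coefficients. -/
noncomputable def freeSingle (x : X) (γ : G) : 𝒜 (γ - deg x) →+ (free 𝒜 deg).obj γ :=
  DFinsupp.singleAddHom (fun x : X => 𝒜 (γ - deg x)) x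

theorem free_act_single {α β γ : G} (h : α + β = γ) (a : 𝒜 α) (x : X) (b : 𝒜 (β - deg x)) :
    (free 𝒜 deg).act h a (freeSingle 𝒜 x β b) =
      freeSingle 𝒜 x γ (mulHom 𝒜 (show α + (β - deg x) = γ - deg x by rw [← h]; abel) a b) := by
  classical
  exact DFinsupp.mapRange_single (hf := fun _ => map_zero _)

theorem free_addHom_ext {γ : G} {H : Type*} [AddCommGroup H] {f g : (free 𝒜 deg).obj γ →+ H}
    (h : ∀ x a, f (freeSingle 𝒜 x γ a) = g (freeSingle 𝒜 x γ a)) : f = g := by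
  classical
  exact DFinsupp.addHom_ext h

open Classical in
/-- The morphism out of a free module with given values on the generators. -/
noncomputable def freeLift (M : GrMod.{w, v', u, k} 𝒜) (e : ∀ x, M.obj (deg x)) (γ : G) :
    (free 𝒜 deg).obj γ →+ M.obj γ :=
  DFinsupp.sumAddHom fun x => (M.act (sub_add_cancel γ (deg x))).flip (e x)

theorem freeLift_single (M : GrMod.{w, v', u, k} 𝒜) (e : ∀ x, M.obj (deg x)) (γ : G) (x : X)
    (a : 𝒜 (γ - deg x)) :
    freeLift 𝒜 M e γ (freeSingle 𝒜 x γ a) = M.act (sub_add_cancel γ (deg x)) a (e x) := by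
  classical
  exact DFinsupp.sumAddHom_single _ _ _

theorem freeLift_act (M : GrMod.{w, v', u, k} 𝒜) (e : ∀ x, M.obj (deg x)) {α β γ : G}
    (h : α + β = γ) (a : 𝒜 α) (m : (free 𝒜 deg).obj β) :
    freeLift 𝒜 M e γ ((free 𝒜 deg).act h a m) = M.act h a (freeLift 𝒜 M e β m) := by
  suffices H : (freeLift 𝒜 M e γ).comp ((free 𝒜 deg).act h a) =
      (M.act h a).comp (freeLift 𝒜 M e β) from DFunLike.congr_fun H m
  refine free_addHom_ext 𝒜 fun x b => ?_
  simp only [AddMonoidHom.comp_apply, free_act_single, freeLift_single]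
  exact (act_act 𝒜 _ _ _ a b _ rfl _).symm

end Free

section Projective

variable {K : Type k} {G A : Type u} [Field K] [AddCommGroup G] [Ring A] [Algebra K A]
variable (𝒜 : Grading K G A) [SetLike.GradedMonoid 𝒜] {X : Type u} (deg : X → G)

instance free_projective : Projective (free 𝒜 deg : GrMod.{u, u, u, k} 𝒜) where
  factors {E Y} g p _ := by
    let e (x : X) : E.obj (deg x) := Function.surjInv (app_surjective p (deg x))
      (g.app (deg x) (freeSingle 𝒜 x (deg x) ⟨1, by
        rw [sub_self]; exact SetLike.GradedOne.one_mem⟩))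
    have he (x : X) := Function.surjInv_eq (app_surjective p (deg x))
      (g.app (deg x) (freeSingle 𝒜 x (deg x) ⟨1, by
        rw [sub_self]; exact SetLike.GradedOne.one_mem⟩))
    refine ⟨⟨fun γ => freeLift 𝒜 E e γ, fun h a m => freeLift_act 𝒜 E e h a m⟩, ?_⟩
    apply Hom.ext
    funext γ
    refine free_addHom_ext 𝒜 fun x a => ?_
    change p.app γ (freeLift 𝒜 E e γ (freeSingle 𝒜 x γ a)) = _
    rw [freeLift_single, p.map_act]
    erw [he x]
    rw [← g.map_act, free_act_single]
    congr 2
    exact Subtype.ext (mul_one _)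

/-- The family of all homogeneous elements of a graded module. -/
noncomputable abbrev cover (M : GrMod.{u, u, u, k} 𝒜) : GrMod.{u, u, u, k} 𝒜 :=
  free 𝒜 (fun x : Σ γ, M.obj γ => x.1)

/-- The canonical map from the free module on all homogeneous elements. -/
noncomputable def coverπ (M : GrMod.{u, u, u, k} 𝒜) : cover 𝒜 M ⟶ M where
  app γ := freeLift 𝒜 M (fun x => x.2) γ
  map_act h a m := freeLift_act 𝒜 M _ h a m

theorem coverπ_surjective (M : GrMod.{u, u, u, k} 𝒜) (γ : G) :
    Function.Surjective ((coverπ 𝒜 M).app γ) := fun m =>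
  ⟨freeSingle 𝒜 (deg := fun x : Σ γ, M.obj γ => x.1) ⟨γ, m⟩ γ ⟨1, by
    rw [sub_self]; exact SetLike.GradedOne.one_mem⟩,
    (freeLift_single 𝒜 M _ γ _ _).trans (act_one_eq 𝒜 _ _ rfl m)⟩

end Projective

end GrMod

set_option linter.unusedSectionVars false

section NormalQuotient

variable {K : Type k} {G : Type w} {A B : Type u} [Field K] [AddCommGroup G]
variable [Ring A] [Algebra K A] [Ring B] [Algebra K B]

/-- `A` is the direct sum of its homogeneous pieces. -/
def HasDecomposition (𝒜 : Grading K G A) : Prop :=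
  (∃ D : A →ₗ[K] (G →₀ A), ∀ γ, ∀ a ∈ 𝒜 γ, D a = Finsupp.single γ a) ∧ ⨆ γ, 𝒜 γ = ⊤

theorem HasDecomposition.induction {𝒜 : Grading K G A} (hA : HasDecomposition 𝒜) {p : A → Prop}
    (h0 : p 0) (hom : ∀ γ, ∀ a ∈ 𝒜 γ, p a) (hadd : ∀ a b, p a → p b → p (a + b)) (a : A) : p a :=
  Submodule.iSup_induction 𝒜 (motive := p) (hA.2 ▸ Submodule.mem_top : a ∈ ⨆ γ, 𝒜 γ) hom h0 hadd

/-- `f : A → B` is the projection to the quotient of the graded algebra `A` by its regular normal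
homogeneous element `z` of degree `ε`, and `z` induces the automorphism `σ` of `A`. -/
structure NormalQuotient (𝒜 : Grading K G A) (ℬ : Grading K G B) (f : A →ₐ[K] B) (z : A) (ε : G)
    (σ : gradedAut 𝒜) : Prop where
  decomposition : HasDecomposition 𝒜
  mem : z ∈ 𝒜 ε
  comm : ∀ a, z * a = σ.1 a * z
  eq_zero_of_mul : ∀ a, a * z = 0 → a = 0
  map_mem : ∀ γ a, a ∈ 𝒜 γ → f a ∈ ℬ γ
  exists_lift : ∀ γ, ∀ b ∈ ℬ γ, ∃ a ∈ 𝒜 γ, f a = b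
  map_eq_zero_iff : ∀ a, f a = 0 ↔ ∃ b, a = b * z

theorem HasDecomposition.apply_mul {𝒜 : Grading K G A} [SetLike.GradedMonoid 𝒜] (hA : HasDecomposition 𝒜)
    {D : A →ₗ[K] (G →₀ A)} (hD : ∀ γ, ∀ a ∈ 𝒜 γ, D a = Finsupp.single γ a)
    {z : A} {ε : G} (hz : z ∈ 𝒜 ε) (x : A) (δ : G) : D (x * z) (ε + δ) = D x δ * z := by
  refine hA.induction (p := fun x => D (x * z) (ε + δ) = D x δ * z) ?_ ?_ ?_ x
  · simp
  · intro α x hx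
    have hxz : x * z ∈ 𝒜 (ε + α) := add_comm α ε ▸ SetLike.GradedMul.mul_mem hx hz
    rw [hD α x hx, hD _ _ hxz]
    by_cases e : α = δ
    · subst e; simp
    · rw [Finsupp.single_eq_of_ne (Ne.symm e),
        Finsupp.single_eq_of_ne (fun t => e (add_left_cancel t).symm)]
      simp
  · intro x y hx hy
    rw [add_mul, map_add D, map_add D, Finsupp.add_apply, Finsupp.add_apply, hx, hy, add_mul]

theorem HasDecomposition.mem_of_mul_mem {𝒜 : Grading K G A} [SetLike.GradedMonoid 𝒜]
    (hA : HasDecomposition 𝒜) {z : A} {ε : G} (hz : z ∈ 𝒜 ε) (hreg : ∀ a, a * z = 0 → a = 0)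
    {β γ : G} (h : ε + β = γ) {a : A} (ha : a * z ∈ 𝒜 γ) : a ∈ 𝒜 β := by
  obtain ⟨D, hD⟩ := hA.1
  have h₁ (x : A) : D x β ∈ 𝒜 β := by
    refine hA.induction (p := fun x => D x β ∈ 𝒜 β) ?_ ?_ ?_ x
    · simp
    · intro α x hx
      rw [hD α x hx]
      by_cases e : α = β
      · subst e; simpa using hx
      · rw [Finsupp.single_eq_of_ne (Ne.symm e)]
        exact zero_mem _
    · intro x y hx hy
      rw [map_add D]
      exact add_mem hx hy
  have h₂ := hA.apply_mul hD hz a β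
  rw [h, hD γ _ ha, Finsupp.single_eq_same] at h₂
  have h₃ := hreg (a - D a β) (by rw [sub_mul, ← h₂, sub_self])
  rw [sub_eq_zero.1 h₃]
  exact h₁ a

namespace NormalQuotient

variable {𝒜 : Grading K G A} [SetLike.GradedMonoid 𝒜]
variable {ℬ : Grading K G B} [SetLike.GradedMonoid ℬ]
variable {f : A →ₐ[K] B} {z : A} {ε : G} {σ : gradedAut 𝒜} (Q : NormalQuotient 𝒜 ℬ f z ε σ)

include Q

theorem map_self : f z = 0 := (Q.map_eq_zero_iff z).2 ⟨1, (one_mul z).symm⟩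

theorem exists_mul_eq {β γ : G} (h : ε + β = γ) {a : A} (ha : a ∈ 𝒜 γ) (hfa : f a = 0) :
    ∃ b ∈ 𝒜 β, a = b * z := by
  obtain ⟨b, rfl⟩ := (Q.map_eq_zero_iff a).1 hfa
  exact ⟨b, Q.decomposition.mem_of_mul_mem Q.mem Q.eq_zero_of_mul h ha, rfl⟩

theorem eq_zero_of_self_mul (a : A) (h : z * a = 0) : a = 0 := by
  rw [Q.comm] at h
  exact (EmbeddingLike.map_eq_zero_iff (f := σ.1)).1 (Q.eq_zero_of_mul _ h)

theorem aut_self : σ.1 z = z := by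
  rw [← sub_eq_zero]
  apply Q.eq_zero_of_mul
  rw [sub_mul, ← Q.comm, sub_self]

theorem aut_symm_self_mul (a : A) : σ.1.symm (z * a) = a * z := by
  rw [AlgEquiv.symm_apply_eq, map_mul, Q.aut_self, Q.comm]

theorem aut_symm_mem {γ : G} {a : A} (ha : a ∈ 𝒜 γ) : σ.1.symm a ∈ 𝒜 γ := by
  rw [← σ.2 γ]
  simpa using ha

end NormalQuotient

end NormalQuotient

namespace NormalQuotient

section Module

variable {K : Type k} {G : Type w} {A B : Type u} [Field K] [AddCommGroup G]
variable [Ring A] [Algebra K A] [Ring B] [Algebra K B]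
variable {𝒜 : Grading K G A} [SetLike.GradedMonoid 𝒜]
variable {ℬ : Grading K G B} [SetLike.GradedMonoid ℬ]
variable {f : A →ₐ[K] B} {z : A} {ε : G} {σ : gradedAut 𝒜} (Q : NormalQuotient 𝒜 ℬ f z ε σ)

/-- The action of `z` on a graded module. -/
def act (M : GrMod.{w, v, u, k} 𝒜) {β γ : G} (h : ε + β = γ) : M.obj β →+ M.obj γ :=
  M.act h ⟨z, Q.mem⟩

/-- Restriction of scalars along the quotient map. -/
abbrev res : GrMod.{w, v, u, k} ℬ ⥤ GrMod.{w, v, u, k} 𝒜 :=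
  GrMod.restrictFunctor f Q.map_mem

theorem act_res (N : GrMod.{w, v, u, k} ℬ) {β γ : G} (h : ε + β = γ) (n : N.obj β) :
    Q.act (Q.res.obj N) h n = 0 := by
  have e : (⟨f z, Q.map_mem _ _ Q.mem⟩ : ℬ ε) = 0 := Subtype.ext Q.map_self
  change N.act h ⟨f z, Q.map_mem _ _ Q.mem⟩ n = 0
  rw [e]
  simp

theorem map_act {M N : GrMod.{w, v, u, k} 𝒜} (g : M ⟶ N) {β γ : G} (h : ε + β = γ) (m : M.obj β) :
    g.app γ (Q.act M h m) = Q.act N h (g.app β m) :=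
  g.map_act h _ m

theorem act_act (M : GrMod.{w, v, u, k} 𝒜) {α β γ δ ζ : G} (h : α + β = γ) (hγ : ε + γ = δ)
    (hβ : ε + β = ζ) (h' : α + ζ = δ) (a : 𝒜 α) (m : M.obj β) :
    Q.act M hγ (M.act h a m) = M.act h' ⟨σ.1 a, (σ.2 _ _).2 a.2⟩ (Q.act M hβ m) := by
  have hc : z * a.1 ∈ 𝒜 (ε + α) := SetLike.GradedMul.mul_mem Q.mem a.2
  have e : ε + α + β = δ := by rw [← hγ, ← h, add_assoc]
  exact (GrMod.act_act 𝒜 h hγ e ⟨z, Q.mem⟩ a ⟨z * a.1, hc⟩ rfl m).trans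
    (GrMod.act_act 𝒜 hβ h' e _ ⟨z, Q.mem⟩ ⟨z * a.1, hc⟩ (Q.comm _) m).symm

/-- A morphism `M ⟶ N` which identifies `N` with `M / zM`, where `z` acts injectively on `M`. -/
structure IsReduction {M : GrMod.{w, v, u, k} 𝒜} {N : GrMod.{w, v, u, k} ℬ}
    (η : M ⟶ Q.res.obj N) : Prop where
  eq_zero_of_act : ∀ {β γ : G} (h : ε + β = γ) (m : M.obj β), Q.act M h m = 0 → m = 0
  surjective : ∀ γ, Function.Surjective (η.app γ)
  exists_act_eq : ∀ {β γ : G} (h : ε + β = γ) (m : M.obj γ), η.app γ m = 0 →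
    ∃ m', Q.act M h m' = m

theorem app_act {M : GrMod.{w, v, u, k} 𝒜} {N : GrMod.{w, v, u, k} ℬ}
    (η : M ⟶ Q.res.obj N) {β γ : G} (h : ε + β = γ) (m : M.obj β) : η.app γ (Q.act M h m) = 0 :=
  (Q.map_act η h m).trans (Q.act_res N h _)

/-- The action of `A` on `M / zM`. -/
noncomputable def redAct (M : GrMod.{w, v, u, k} 𝒜) {α β γ : G} (h : α + β = γ) :
    𝒜 α →+ (M.obj β ⧸ (Q.act M (add_sub_cancel ε β)).range) →+
      (M.obj γ ⧸ (Q.act M (add_sub_cancel ε γ)).range) where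
  toFun a := QuotientAddGroup.map _ _ (M.act h a) (by
    rintro _ ⟨m, rfl⟩
    refine ⟨M.act (by rw [← h]; abel) ⟨σ.1.symm a, Q.aut_symm_mem a.2⟩ m, ?_⟩
    rw [Q.act_act M _ _ (add_sub_cancel ε β) h]
    congr 2
    exact Subtype.ext (σ.1.apply_symm_apply _))
  map_zero' := by ext; simp
  map_add' _ _ := by ext; simp

theorem redAct_eq_zero (M : GrMod.{w, v, u, k} 𝒜) {α β γ : G} (h : α + β = γ) (a : 𝒜 α)
    (ha : f a = 0) : Q.redAct M h a = 0 := by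
  obtain ⟨b, hb, e⟩ := Q.exists_mul_eq (add_sub_cancel ε α) a.2 ha
  ext m
  refine (QuotientAddGroup.eq_zero_iff _).2
    ⟨M.act (by rw [← h]; abel) ⟨σ.1.symm b, Q.aut_symm_mem hb⟩ m, ?_⟩
  rw [Q.act_act M _ _ rfl (by rw [← h]; abel)]
  exact GrMod.act_act 𝒜 _ _ h _ _ a (by simpa using e) m

/-- The lift of a homogeneous element of `B` to `A`. -/
noncomputable def lift {γ : G} (b : ℬ γ) : 𝒜 γ :=
  ⟨(Q.exists_lift γ b.1 b.2).choose, (Q.exists_lift γ b.1 b.2).choose_spec.1⟩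

theorem map_lift {γ : G} (b : ℬ γ) : f (Q.lift b).1 = b := (Q.exists_lift γ b.1 b.2).choose_spec.2

theorem redAct_congr (M : GrMod.{w, v, u, k} 𝒜) {α β γ : G} (h : α + β = γ) (a a' : 𝒜 α)
    (e : f a = f a') : Q.redAct M h a = Q.redAct M h a' := by
  rw [← sub_eq_zero, ← map_sub]
  exact Q.redAct_eq_zero M h _ (by simp [e])

/-- The graded `B`-module `M / zM`. -/
noncomputable def red (M : GrMod.{w, v, u, k} 𝒜) : GrMod.{w, v, u, k} ℬ where
  obj γ := M.obj γ ⧸ (Q.act M (add_sub_cancel ε γ)).range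
  act h :=
    { toFun := fun b => Q.redAct M h (Q.lift b)
      map_zero' := Q.redAct_eq_zero M h _ (by simp [map_lift])
      map_add' := fun b c => by
        rw [← map_add]
        exact Q.redAct_congr M h _ _ (by simp [map_lift]) }
  one_act h m := by
    change Q.redAct M h _ m = m
    rw [Q.redAct_congr M h _ ⟨1, SetLike.GradedOne.one_mem⟩ (by simp [map_lift])]
    induction m using QuotientAddGroup.induction_on with
    | H m => exact congrArg _ (M.one_act h m)
  mul_act h₁ h₂ h a b m := by
    change Q.redAct M h _ m = Q.redAct M h₂ _ (Q.redAct M h₁ _ m)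
    rw [Q.redAct_congr M h _ ⟨Q.lift a * Q.lift b, SetLike.GradedMul.mul_mem (Q.lift a).2
      (Q.lift b).2⟩ (by simp [map_lift])]
    induction m using QuotientAddGroup.induction_on with
    | H m => exact congrArg _ (M.mul_act h₁ h₂ h _ _ m)

/-- The projection `M ⟶ M / zM`. -/
noncomputable def redπ (M : GrMod.{w, v, u, k} 𝒜) : M ⟶ Q.res.obj (Q.red M) where
  app γ := QuotientAddGroup.mk' _
  map_act {α β γ} h a m := by
    change _ = Q.redAct M h _ _
    rw [Q.redAct_congr M h _ a (Q.map_lift _)]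
    rfl

theorem isReduction_redπ {M : GrMod.{w, v, u, k} 𝒜}
    (hM : ∀ {β γ : G} (h : ε + β = γ) (m : M.obj β), Q.act M h m = 0 → m = 0) :
    Q.IsReduction (Q.redπ M) where
  eq_zero_of_act := hM
  surjective γ := QuotientAddGroup.mk'_surjective _
  exists_act_eq {β γ} h m hm := by
    obtain rfl : β = γ - ε := by rw [← h]; abel
    exact (QuotientAddGroup.eq_zero_iff _).1 hm

variable {Q}

namespace IsReduction

variable {M : GrMod.{w, v, u, k} 𝒜} {N : GrMod.{w, v, u, k} ℬ} {η : M ⟶ Q.res.obj N}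
  (hη : Q.IsReduction η)

include hη in
theorem hom_ext {N' : GrMod.{w, v, u, k} ℬ} {g g' : N ⟶ N'}
    (h : η ≫ Q.res.map g = η ≫ Q.res.map g') : g = g' :=
  GrMod.hom_ext fun γ n => by
    obtain ⟨m, rfl⟩ := hη.surjective γ n
    exact congrArg (fun t : M ⟶ Q.res.obj N' => t.app γ m) h

/-- The morphism of `B`-modules on `N = M / zM` induced by a morphism of `A`-modules on `M`. -/
noncomputable def desc {N' : GrMod.{w, v, u, k} ℬ} (g : M ⟶ Q.res.obj N') : N ⟶ N' where
  app γ := (η.app γ).liftOfSurjective (hη.surjective γ) ⟨g.app γ, fun m hm => by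
    obtain ⟨m', rfl⟩ := hη.exists_act_eq (add_sub_cancel ε γ) m hm
    exact Q.app_act g _ m'⟩
  map_act {α β γ} h b n := by
    obtain ⟨a, ha, e⟩ := Q.exists_lift α b.1 b.2
    obtain ⟨m, rfl⟩ := hη.surjective β n
    obtain rfl : (⟨f a, Q.map_mem _ _ ha⟩ : ℬ α) = b := Subtype.ext e
    refine (congrArg _ (η.map_act h ⟨a, ha⟩ m).symm).trans ?_
    erw [AddMonoidHom.liftOfRightInverse_comp_apply, AddMonoidHom.liftOfRightInverse_comp_apply]
    exact g.map_act h ⟨a, ha⟩ m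

theorem desc_app {N' : GrMod.{w, v, u, k} ℬ} (g : M ⟶ Q.res.obj N') {γ : G} (m : M.obj γ) :
    (hη.desc g).app γ (η.app γ m) = g.app γ m :=
  AddMonoidHom.liftOfRightInverse_comp_apply _ _ _ _ _

theorem comp_desc {N' : GrMod.{w, v, u, k} ℬ} (g : M ⟶ Q.res.obj N') :
    η ≫ Q.res.map (hη.desc g) = g :=
  GrMod.hom_ext fun _ m => hη.desc_app g m

include hη in
theorem projective [Projective M] : Projective N where
  factors {E Y} g p _ := by
    have : Epi (Q.res.map p) := inferInstance
    let t := Projective.factorThru (η ≫ Q.res.map g) (Q.res.map p)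
    refine ⟨hη.desc t, hη.hom_ext ?_⟩
    rw [Functor.map_comp, ← Category.assoc, comp_desc]
    exact Projective.factorThru_comp _ _

end IsReduction

end Module

end NormalQuotient

namespace NormalQuotient

open Abelian

variable {K : Type k} {G A B : Type u} [Field K] [AddCommGroup G]
variable [Ring A] [Algebra K A] [Ring B] [Algebra K B]
variable {𝒜 : Grading K G A} [SetLike.GradedMonoid 𝒜]
variable {ℬ : Grading K G B} [SetLike.GradedMonoid ℬ]
variable {f : A →ₐ[K] B} {z : A} {ε : G} {σ : gradedAut 𝒜} (Q : NormalQuotient 𝒜 ℬ f z ε σ)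

theorem free_eq_zero_of_act {X : Type u} {deg : X → G} {β γ : G} (h : ε + β = γ)
    (m : (GrMod.free 𝒜 deg : GrMod.{u, u, u, k} 𝒜).obj β) (hm : Q.act _ h m = 0) : m = 0 :=
  DFinsupp.ext fun x => Subtype.ext <| Q.eq_zero_of_self_mul _ <|
    congrArg (fun t : Π₀ x : X, 𝒜 (γ - deg x) => (t x).1) hm

theorem ker_eq_zero_of_act {M N : GrMod.{u, u, u, k} 𝒜} (g : M ⟶ N)
    (hM : ∀ {β γ : G} (h : ε + β = γ) (m : M.obj β), Q.act M h m = 0 → m = 0)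
    {β γ : G} (h : ε + β = γ) (m : (GrMod.ker g).obj β) (hm : Q.act _ h m = 0) : m = 0 :=
  Subtype.ext (hM h m.1 (congrArg Subtype.val hm))

/-- The exact sequence of a kernel. -/
theorem shortExact_ker {A : Type u} [Ring A] [Algebra K A] {𝒜 : Grading K G A}
    [SetLike.GradedMonoid 𝒜] {M N : GrMod.{u, u, u, k} 𝒜} (g : M ⟶ N)
    (hg : ∀ γ, Function.Surjective (g.app γ)) :
    (ShortComplex.mk (GrMod.kerι g) g (GrMod.kerι_comp g)).ShortExact :=
  GrMod.shortExact_of_exact (fun _ => Subtype.val_injective) (fun _ m hm => ⟨⟨m, hm⟩, rfl⟩) hg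

/-- The comparison map `Ext_B(N, N') → Ext_A(M, N')` defined by a morphism `M ⟶ N`. -/
noncomputable def extRes {M : GrMod.{u, u, u, k} 𝒜} {N : GrMod.{u, u, u, k} ℬ}
    (η : M ⟶ Q.res.obj N) (N' : GrMod.{u, u, u, k} ℬ) (n : ℕ) :
    Ext.{u + 1} N N' n →+ Ext.{u + 1} M (Q.res.obj N') n :=
  extChange Q.res η (N := N') (Ext.mk₀ (𝟙 (Q.res.obj N'))) (add_zero n)

theorem extRes_mk₀ {M : GrMod.{u, u, u, k} 𝒜} {N : GrMod.{u, u, u, k} ℬ}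
    (η : M ⟶ Q.res.obj N) (N' : GrMod.{u, u, u, k} ℬ) (g : N ⟶ N') :
    Q.extRes η N' 0 (Ext.mk₀ g) = Ext.mk₀ (η ≫ Q.res.map g) := by
  rw [extRes, extChange_apply, Ext.mapExactFunctor_mk₀, Ext.comp_mk₀_id, Ext.mk₀_comp_mk₀]

theorem IsReduction.extRes_zero_bijective {M : GrMod.{u, u, u, k} 𝒜} {N : GrMod.{u, u, u, k} ℬ}
    {η : M ⟶ Q.res.obj N} (hη : Q.IsReduction η) (N' : GrMod.{u, u, u, k} ℬ) :
    Function.Bijective (Q.extRes η N' 0) := by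
  constructor
  · intro x y hxy
    obtain ⟨x, rfl⟩ := (Ext.mk₀_bijective _ _).2 x
    obtain ⟨y, rfl⟩ := (Ext.mk₀_bijective _ _).2 y
    rw [extRes_mk₀, extRes_mk₀] at hxy
    rw [hη.hom_ext ((Ext.mk₀_bijective _ _).1 hxy)]
  · intro y
    obtain ⟨y, rfl⟩ := (Ext.mk₀_bijective _ _).2 y
    exact ⟨Ext.mk₀ (hη.desc y), by rw [extRes_mk₀, hη.comp_desc]⟩

/-- Change of rings for a module on which `z` acts injectively. -/
theorem IsReduction.extRes_bijective (N' : GrMod.{u, u, u, k} ℬ) (n : ℕ) :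
    ∀ {M : GrMod.{u, u, u, k} 𝒜} {N : GrMod.{u, u, u, k} ℬ} {η : M ⟶ Q.res.obj N},
      Q.IsReduction η → Function.Bijective (Q.extRes η N' n) := by
  induction n with
  | zero => exact fun hη => hη.extRes_zero_bijective Q N'
  | succ n ih =>
    intro M N η hη
    let P := GrMod.cover 𝒜 M
    let π : P ⟶ M := GrMod.coverπ 𝒜 M
    have hπ := GrMod.coverπ_surjective 𝒜 M
    have hηP : Q.IsReduction (Q.redπ P) := Q.isReduction_redπ Q.free_eq_zero_of_act
    have hηK : Q.IsReduction (Q.redπ (GrMod.ker π)) :=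
      Q.isReduction_redπ (Q.ker_eq_zero_of_act π Q.free_eq_zero_of_act)
    let i := hηK.desc (GrMod.kerι π ≫ Q.redπ P)
    let p := hηP.desc (π ≫ η)
    have hi {γ : G} := hηK.desc_app (γ := γ) (GrMod.kerι π ≫ Q.redπ P)
    have hp {γ : G} := hηP.desc_app (γ := γ) (π ≫ η)
    have hip : i ≫ p = 0 := hηK.hom_ext (GrMod.hom_ext fun γ x => by
      change p.app γ (i.app γ ((Q.redπ (GrMod.ker π)).app γ x)) = 0
      rw [hi x]
      refine (hp x.1).trans ?_
      change η.app γ (π.app γ x.1) = 0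
      rw [show π.app γ x.1 = 0 from x.2, map_zero])
    have hS' := shortExact_ker π hπ
    have hS : (ShortComplex.mk i p hip).ShortExact := by
      refine GrMod.shortExact_of_exact (fun γ => ?_) (fun γ y hy => ?_) (fun γ y => ?_)
      · rw [injective_iff_map_eq_zero]
        intro y hy
        obtain ⟨x, rfl⟩ := hηK.surjective γ y
        rw [hi x] at hy
        obtain ⟨x', hx'⟩ := hηP.exists_act_eq (add_sub_cancel ε γ) x.1 hy
        have hx'' : π.app _ x' = 0 := by
          apply hη.eq_zero_of_act (add_sub_cancel ε γ)
          rw [← Q.map_act, hx']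
          exact x.2
        have : x = Q.act (GrMod.ker π) (add_sub_cancel ε γ) ⟨x', hx''⟩ := Subtype.ext hx'.symm
        rw [this]
        exact Q.app_act _ _ _
      · obtain ⟨x, rfl⟩ := hηP.surjective γ y
        have hx : η.app γ (π.app γ x) = 0 := (hp x).symm.trans hy
        obtain ⟨m', hm'⟩ := hη.exists_act_eq (add_sub_cancel ε γ) _ hx
        obtain ⟨x', rfl⟩ := hπ _ m'
        refine ⟨(Q.redπ (GrMod.ker π)).app γ ⟨x - Q.act P (add_sub_cancel ε γ) x', ?_⟩, ?_⟩
        · rw [AddMonoidHom.mem_ker, map_sub, ← hm', sub_eq_zero]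
          exact (Q.map_act π _ x').symm
        · refine (hi _).trans ?_
          change (Q.redπ P).app γ (x - _) = _
          rw [map_sub, Q.app_act, sub_zero]
      · obtain ⟨m, rfl⟩ := hη.surjective γ y
        obtain ⟨x, rfl⟩ := hπ _ m
        exact ⟨(Q.redπ P).app γ x, hp x⟩
    have := hηP.projective
    refine extChange_bijective_succ Q.res hS hS' (Q.redπ _) (Q.redπ P) η
      (hηK.comp_desc _).symm (hηP.comp_desc _).symm _ (add_zero n) (add_zero (n + 1))
      (add_comm 1 n) (add_comm 1 n) (ih hηK) ?_ (Ext.subsingleton_of_projective _ _ _)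
      (Ext.subsingleton_of_projective _ _ _)
    cases n with
    | zero => exact (hηP.extRes_zero_bijective Q N').2
    | succ n =>
      have : Subsingleton (Ext.{u + 1} P (Q.res.obj N') (n + 1)) :=
        Ext.subsingleton_of_projective _ _ _
      exact fun y => ⟨0, Subsingleton.elim _ _⟩

end NormalQuotient

namespace NormalQuotient

open Abelian

variable {K : Type k} {G A B : Type u} [Field K] [AddCommGroup G]
variable [Ring A] [Algebra K A] [Ring B] [Algebra K B]
variable {𝒜 : Grading K G A} [SetLike.GradedMonoid 𝒜]
variable {ℬ : Grading K G B} [SetLike.GradedMonoid ℬ]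
variable {f : A →ₐ[K] B} {z : A} {ε : G} {σ : gradedAut 𝒜} (Q : NormalQuotient 𝒜 ℬ f z ε σ)

/-- The projection `Σ_γ A ⟶ Σ_γ B`. -/
def shiftProj (γ : G) :
    GrMod.shift γ (GrMod.regular 𝒜) ⟶ Q.res.obj (GrMod.shift γ (GrMod.regular ℬ)) where
  app _ :=
    { toFun := fun x => ⟨f x.1, Q.map_mem _ _ x.2⟩
      map_zero' := Subtype.ext (map_zero f)
      map_add' := fun _ _ => Subtype.ext (map_add f _ _) }
  map_act _ _ _ := Subtype.ext (map_mul f _ _)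

theorem rightMul_comp_shiftProj {β γ : G} (h : ε + β = γ) :
    GrMod.rightMul 𝒜 h ⟨z, Q.mem⟩ ≫ Q.shiftProj γ = 0 := by
  ext δ x
  refine Subtype.ext ?_
  change f (x.1 * z) = 0
  rw [map_mul, Q.map_self, mul_zero]

/-- The sequence `0 → Σ_β A → Σ_γ A → Σ_γ B → 0`, with `γ = ε + β`. -/
abbrev mulSeq {β γ : G} (h : ε + β = γ) : ShortComplex (GrMod.{u, u, u, k} 𝒜) :=
  ShortComplex.mk _ _ (Q.rightMul_comp_shiftProj h)

theorem mulSeq_shortExact {β γ : G} (h : ε + β = γ) : (Q.mulSeq h).ShortExact := by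
  refine GrMod.shortExact_of_exact (fun δ => ?_) (fun δ x hx => ?_) (fun δ y => ?_)
  · rw [injective_iff_map_eq_zero]
    intro x hx
    exact Subtype.ext (Q.eq_zero_of_mul _ (congrArg Subtype.val hx))
  · obtain ⟨b, hb, e⟩ := Q.exists_mul_eq (show ε + (β + δ) = γ + δ by rw [← h, add_assoc]) x.2
      (congrArg Subtype.val hx)
    exact ⟨⟨b, hb⟩, Subtype.ext e.symm⟩
  · obtain ⟨a, ha, e⟩ := Q.exists_lift _ _ y.2
    exact ⟨⟨a, ha⟩, Subtype.ext e⟩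

theorem res_full {N N' : GrMod.{u, u, u, k} ℬ} (t : Q.res.obj N ⟶ Q.res.obj N') :
    ∃ t' : N ⟶ N', Q.res.map t' = t :=
  ⟨{ app := t.app
     map_act := fun {α _ _} h b n => by
      obtain ⟨a, ha, e⟩ := Q.exists_lift α b.1 b.2
      obtain rfl : (⟨f a, Q.map_mem _ _ ha⟩ : ℬ α) = b := Subtype.ext e
      exact t.map_act h ⟨a, ha⟩ n }, rfl⟩

theorem res_faithful {N N' : GrMod.{u, u, u, k} ℬ} {t t' : N ⟶ N'}
    (h : Q.res.map t = Q.res.map t') : t = t' :=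
  GrMod.hom_ext fun γ n => congrArg (fun s : Q.res.obj N ⟶ Q.res.obj N' => s.app γ n) h

theorem hom_regular_eq_zero {N : GrMod.{u, u, u, k} ℬ} {β : G}
    (g : Q.res.obj N ⟶ GrMod.shift β (GrMod.regular 𝒜)) : g = 0 := by
  ext δ n
  refine Subtype.ext (Q.eq_zero_of_self_mul _ ?_)
  have := g.map_act (rfl : ε + δ = ε + δ) ⟨z, Q.mem⟩ n
  rw [show (Q.res.obj N).act rfl ⟨z, Q.mem⟩ n = 0 from Q.act_res N rfl n, map_zero] at this
  exact (congrArg Subtype.val this).symm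

/-- The action of `z` on `P`, with values in the kernel of a morphism to a module killed by `z`. -/
def kerAct {P : GrMod.{u, u, u, k} 𝒜} {N : GrMod.{u, u, u, k} ℬ} (π : P ⟶ Q.res.obj N) (δ : G) :
    P.obj δ →+ (GrMod.ker π).obj (ε + δ) :=
  (Q.act P rfl).codRestrict (π.app (ε + δ)).ker (Q.app_act π rfl)

/-- The extension of `g z` from the kernel of `P ⟶ N` to `P`, for a module `N` killed by `z`. -/
def twistedExtension {P : GrMod.{u, u, u, k} 𝒜} {N : GrMod.{u, u, u, k} ℬ} (π : P ⟶ Q.res.obj N)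
    {β γ : G} (h : ε + β = γ) (g : GrMod.ker π ⟶ GrMod.shift β (GrMod.regular 𝒜)) :
    P ⟶ GrMod.shift γ (GrMod.regular 𝒜) where
  app δ :=
    { toFun := fun x => ⟨σ.1.symm (g.app (ε + δ) (Q.kerAct π δ x)).1, by
        rw [show γ + δ = β + (ε + δ) by rw [← h]; abel]
        exact Q.aut_symm_mem (g.app (ε + δ) (Q.kerAct π δ x)).2⟩
      map_zero' := Subtype.ext <| by
        rw [map_zero (Q.kerAct π δ), map_zero (g.app (ε + δ))]
        exact map_zero σ.1.symm
      map_add' := fun x y => Subtype.ext <| by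
        rw [map_add (Q.kerAct π δ), map_add (g.app (ε + δ))]
        exact map_add σ.1.symm _ _ }
  map_act {α δ δ'} h' a x := Subtype.ext <| by
    have h'' : α + (ε + δ) = ε + δ' := by rw [← h']; abel
    have e := g.map_act h'' ⟨σ.1 a, (σ.2 _ _).2 a.2⟩ (Q.kerAct π δ x)
    have e' : Q.kerAct π δ' (P.act h' a x) =
        (GrMod.ker π).act h'' ⟨σ.1 a, (σ.2 _ _).2 a.2⟩ (Q.kerAct π δ x) :=
      Subtype.ext (Q.act_act P h' rfl rfl h'' a x)
    change σ.1.symm (g.app (ε + δ') (Q.kerAct π δ' (P.act h' a x))).1 = _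
    rw [e', e]
    change σ.1.symm (σ.1 a.1 * _) = a.1 * _
    rw [map_mul, AlgEquiv.symm_apply_apply]
    rfl

theorem kerι_comp_twistedExtension {P : GrMod.{u, u, u, k} 𝒜} {N : GrMod.{u, u, u, k} ℬ}
    (π : P ⟶ Q.res.obj N) {β γ : G} (h : ε + β = γ)
    (g : GrMod.ker π ⟶ GrMod.shift β (GrMod.regular 𝒜)) :
    GrMod.kerι π ≫ Q.twistedExtension π h g = g ≫ GrMod.rightMul 𝒜 h ⟨z, Q.mem⟩ := by
  ext δ x
  refine Subtype.ext ?_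
  have e := g.map_act (rfl : ε + δ = ε + δ) ⟨z, Q.mem⟩ x
  change σ.1.symm (g.app (ε + δ) ((GrMod.ker π).act rfl ⟨z, Q.mem⟩ x)).1 = (g.app δ x).1 * z
  rw [e]
  exact Q.aut_symm_self_mul _

/-- The comparison map `Ext^n_B(N, Σ_γ B) → Ext^{n + 1}_A(N, Σ_β A)`. -/
noncomputable def extRees (N : GrMod.{u, u, u, k} ℬ) {β γ : G} (h : ε + β = γ) (n : ℕ) :
    Ext.{u + 1} N (GrMod.shift γ (GrMod.regular ℬ)) n →+
      Ext.{u + 1} (Q.res.obj N) (GrMod.shift β (GrMod.regular 𝒜)) (n + 1) :=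
  extChange Q.res (𝟙 (Q.res.obj N)) (Q.mulSeq_shortExact h).extClass rfl

theorem extRees_zero_bijective (N : GrMod.{u, u, u, k} ℬ) {β γ : G} (h : ε + β = γ) :
    Function.Bijective (Q.extRees N h 0) := by
  have key (t : N ⟶ GrMod.shift γ (GrMod.regular ℬ)) : Q.extRees N h 0 (Ext.mk₀ t) =
      (Ext.mk₀ (Q.res.map t)).comp (Q.mulSeq_shortExact h).extClass (zero_add 1) := by
    rw [extRees, extChange_apply, Ext.mapExactFunctor_mk₀, Ext.mk₀_id_comp]
  constructor
  · rw [injective_iff_map_eq_zero]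
    intro x hx
    obtain ⟨t, rfl⟩ := (Ext.mk₀_bijective _ _).2 x
    rw [key] at hx
    obtain ⟨y, hy⟩ := Ext.covariant_sequence_exact₃ _ (Q.mulSeq_shortExact h) _ _ hx
    obtain ⟨s, rfl⟩ := (Ext.mk₀_bijective _ _).2 y
    obtain rfl : s = 0 := Q.hom_regular_eq_zero s
    rw [Ext.mk₀_zero, Ext.zero_comp] at hy
    have := (Ext.mk₀_bijective _ _).1 (hy.symm.trans (Ext.mk₀_zero _ _).symm)
    rw [Q.res_faithful (this.trans (Functor.map_zero _ _ _).symm), Ext.mk₀_zero]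
  · intro y
    let π := GrMod.coverπ 𝒜 (Q.res.obj N)
    have hS := shortExact_ker π (GrMod.coverπ_surjective 𝒜 (Q.res.obj N))
    obtain ⟨y₁, rfl⟩ := Ext.contravariant_sequence_exact₃ hS _ y (Ext.eq_zero_of_projective _)
      (add_zero 1)
    obtain ⟨g, rfl⟩ := (Ext.mk₀_bijective _ _).2 y₁
    have hy : (hS.extClass.comp (Ext.mk₀ g) (add_zero 1)).comp
        (Ext.mk₀ (Q.mulSeq h).f) (add_zero 1) = 0 := by
      rw [Ext.comp_assoc_of_third_deg_zero, Ext.mk₀_comp_mk₀]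
      rw [show g ≫ (Q.mulSeq h).f = GrMod.kerι π ≫ Q.twistedExtension π h g from
        (Q.kerι_comp_twistedExtension π h g).symm, ← Ext.mk₀_comp_mk₀]
      exact hS.extClass_comp_assoc _
    obtain ⟨x, hx⟩ := Ext.covariant_sequence_exact₁ _ (Q.mulSeq_shortExact h) _ hy (zero_add 1)
    obtain ⟨t, rfl⟩ := (Ext.mk₀_bijective _ _).2 x
    obtain ⟨t, rfl⟩ := Q.res_full t
    exact ⟨Ext.mk₀ t, (key t).trans hx⟩

/-- The action of `z` on a free module, as a morphism from a free module with shifted degrees. -/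
noncomputable def freeMul {X : Type u} (deg : X → G) :
    (GrMod.free 𝒜 (fun x => deg x + ε) : GrMod.{u, u, u, k} 𝒜) ⟶ GrMod.free 𝒜 deg where
  app γ := DFinsupp.mapRange.addMonoidHom fun x =>
    { toFun := fun a => ⟨a.1 * z, by
        have := SetLike.GradedMul.mul_mem a.2 Q.mem
        rwa [show γ - (deg x + ε) + ε = γ - deg x by abel] at this⟩
      map_zero' := Subtype.ext (zero_mul z)
      map_add' := fun _ _ => Subtype.ext (add_mul _ _ z) }
  map_act h a m := DFinsupp.ext fun x => Subtype.ext (mul_assoc _ _ _)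

theorem freeMul_injective {X : Type u} (deg : X → G) (γ : G) :
    Function.Injective ((Q.freeMul deg).app γ) := by
  rw [injective_iff_map_eq_zero]
  intro m hm
  exact DFinsupp.ext fun x => Subtype.ext <| Q.eq_zero_of_mul _ <|
    congrArg (fun t : Π₀ x : X, 𝒜 (γ - deg x) => (t x).1) hm

theorem freeMul_single {X : Type u} (deg : X → G) (γ : G) (x : X) (a : 𝒜 (γ - (deg x + ε)))
    (b : 𝒜 (γ - deg x)) (hab : b.1 = a.1 * z) :
    (Q.freeMul deg).app γ (GrMod.freeSingle 𝒜 x γ a) = GrMod.freeSingle 𝒜 x γ b := by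
  classical
  refine (DFinsupp.mapRange_single (hf := fun _ => map_zero _)).trans ?_
  exact congrArg (GrMod.freeSingle 𝒜 x γ) (Subtype.ext hab.symm)

include Q in
theorem free_mul_mem {X : Type u} {deg : X → G} {γ : G} {x : X} (a : 𝒜 (γ - (deg x + ε))) :
    a.1 * z ∈ 𝒜 (γ - deg x) := by
  have := SetLike.GradedMul.mul_mem a.2 Q.mem
  rwa [show γ - (deg x + ε) + ε = γ - deg x by abel] at this

theorem freeMul_comp_redπ {X : Type u} (deg : X → G) :
    Q.freeMul deg ≫ Q.redπ (GrMod.free 𝒜 deg) = 0 := by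
  apply GrMod.Hom.ext
  funext γ
  refine GrMod.free_addHom_ext 𝒜 fun x a => ?_
  change (Q.redπ (GrMod.free 𝒜 deg)).app γ ((Q.freeMul deg).app γ (GrMod.freeSingle 𝒜 x γ a)) = 0
  rw [Q.freeMul_single deg γ x a ⟨_, Q.free_mul_mem a⟩ rfl]
  have ha : σ.1.symm a.1 ∈ 𝒜 (γ - ε - deg x) := by
    rw [show γ - ε - deg x = γ - (deg x + ε) by abel]
    exact Q.aut_symm_mem a.2
  rw [← Q.app_act (Q.redπ _) (add_sub_cancel ε γ) (GrMod.freeSingle 𝒜 x _ ⟨_, ha⟩)]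
  refine congrArg _ ((GrMod.free_act_single 𝒜 _ _ _ _).trans ?_).symm
  refine congrArg (GrMod.freeSingle 𝒜 x γ) (Subtype.ext ?_)
  change z * σ.1.symm a.1 = a.1 * z
  rw [Q.comm, AlgEquiv.apply_symm_apply]

theorem exists_freeMul_eq {X : Type u} (deg : X → G) {γ : G}
    (m : (GrMod.free 𝒜 deg : GrMod.{u, u, u, k} 𝒜).obj γ)
    (hm : (Q.redπ (GrMod.free 𝒜 deg)).app γ m = 0) : ∃ l, (Q.freeMul deg).app γ l = m := by
  obtain ⟨m, rfl⟩ := (Q.isReduction_redπ Q.free_eq_zero_of_act).exists_act_eq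
    (add_sub_cancel ε γ) m hm
  have H : (QuotientAddGroup.mk' ((Q.freeMul deg).app γ).range).comp
      (Q.act (GrMod.free 𝒜 deg) (add_sub_cancel ε γ)) = 0 := by
    refine GrMod.free_addHom_ext 𝒜 fun x a => (QuotientAddGroup.eq_zero_iff _).2 ?_
    have ha : σ.1 a.1 ∈ 𝒜 (γ - (deg x + ε)) := by
      rw [show γ - (deg x + ε) = γ - ε - deg x by abel]
      exact (σ.2 _ _).2 a.2
    refine ⟨GrMod.freeSingle 𝒜 x γ ⟨_, ha⟩, ?_⟩
    rw [Q.freeMul_single deg γ x ⟨_, ha⟩ ⟨_, Q.free_mul_mem ⟨_, ha⟩⟩ rfl]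
    refine ((GrMod.free_act_single 𝒜 _ _ _ _).trans ?_).symm
    exact congrArg (GrMod.freeSingle 𝒜 x γ) (Subtype.ext (Q.comm _))
  exact (QuotientAddGroup.eq_zero_iff _).1 (DFunLike.congr_fun H m)

/-- The free resolution of length one of the reduction of a free module. -/
theorem freeSeq_shortExact {X : Type u} (deg : X → G) :
    (ShortComplex.mk _ _ (Q.freeMul_comp_redπ deg)).ShortExact :=
  GrMod.shortExact_of_exact (Q.freeMul_injective deg) (fun _ m hm => Q.exists_freeMul_eq deg m hm)
    (Q.isReduction_redπ Q.free_eq_zero_of_act).surjective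

theorem subsingleton_ext_red_free {X : Type u} (deg : X → G) (Y : GrMod.{u, u, u, k} 𝒜) (n : ℕ) :
    Subsingleton (Ext.{u + 1} (Q.res.obj (Q.red (GrMod.free 𝒜 deg))) Y (n + 1 + 1)) :=
  subsingleton_of_forall_eq 0 fun y => by
    obtain ⟨y₁, rfl⟩ := Ext.contravariant_sequence_exact₃ (Q.freeSeq_shortExact deg) Y y
      (Ext.eq_zero_of_projective _) (add_comm 1 (n + 1))
    rw [Ext.eq_zero_of_projective y₁, Ext.comp_zero]

/-- Rees's change of rings for a module killed by `z`. -/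
theorem extRees_bijective {β γ : G} (h : ε + β = γ) (n : ℕ) :
    ∀ N : GrMod.{u, u, u, k} ℬ, Function.Bijective (Q.extRees N h n) := by
  induction n with
  | zero => exact fun N => Q.extRees_zero_bijective N h
  | succ n ih =>
    intro N
    let P := GrMod.cover 𝒜 (Q.res.obj N)
    have hηP : Q.IsReduction (Q.redπ P) := Q.isReduction_redπ Q.free_eq_zero_of_act
    have := hηP.projective
    have hS := shortExact_ker (hηP.desc (GrMod.coverπ 𝒜 (Q.res.obj N))) fun γ y => by
      obtain ⟨x, rfl⟩ := GrMod.coverπ_surjective 𝒜 (Q.res.obj N) γ y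
      exact ⟨_, hηP.desc_app _ x⟩
    refine extChange_bijective_succ Q.res hS (hS.map_of_exact Q.res) (𝟙 _) (𝟙 _) (𝟙 _)
      ((Category.comp_id _).trans (Category.id_comp _).symm)
      ((Category.comp_id _).trans (Category.id_comp _).symm) _ rfl rfl
      (add_comm 1 n) (add_comm 1 (n + 1)) (ih _) ?_ (Ext.subsingleton_of_projective _ _ _)
      (Q.subsingleton_ext_red_free _ _ _)
    cases n with
    | zero => exact (Q.extRees_zero_bijective _ h).2
    | succ n =>
      have hs := Q.subsingleton_ext_red_free (fun x : Σ γ, (Q.res.obj N).obj γ => x.1)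
        (GrMod.shift β (GrMod.regular 𝒜)) n
      exact fun y => ⟨0, hs.elim _ _⟩

end NormalQuotient

namespace NormalQuotient

open Abelian

variable {K : Type k} {G A B : Type u} [Field K] [AddCommGroup G]
variable [Ring A] [Algebra K A] [Ring B] [Algebra K B]
variable {𝒜 : Grading K G A} [SetLike.GradedMonoid 𝒜]
variable {ℬ : Grading K G B} [SetLike.GradedMonoid ℬ]
variable {f : A →ₐ[K] B} {z : A} {ε : G} {σ : gradedAut 𝒜} (Q : NormalQuotient 𝒜 ℬ f z ε σ)

theorem extRightMul_self_eq_zero (N : GrMod.{u, u, u, k} ℬ) {β γ : G} (h : ε + β = γ) (n : ℕ)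
    (x : Ext.{u + 1} (Q.res.obj N) (GrMod.shift β (GrMod.regular 𝒜)) n) :
    extRightMul 𝒜 (Q.res.obj N) n h ⟨z, Q.mem⟩ x = 0 := by
  change x.comp (Ext.mk₀ (Q.mulSeq h).f) (add_zero n) = 0
  cases n with
  | zero =>
    obtain ⟨t, rfl⟩ := (Ext.mk₀_bijective _ _).2 x
    obtain rfl : t = 0 := Q.hom_regular_eq_zero t
    rw [Ext.mk₀_zero, Ext.zero_comp]
  | succ n =>
    obtain ⟨w, rfl⟩ := (Q.extRees_bijective h n N).2 x
    change (((Ext.mk₀ _).comp (w.mapExactFunctor Q.res) (zero_add n)).comp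
      (Q.mulSeq_shortExact h).extClass rfl).comp (Ext.mk₀ (Q.mulSeq h).f) (add_zero _) = 0
    rw [Ext.comp_assoc_of_third_deg_zero, (Q.mulSeq_shortExact h).extClass_comp, Ext.comp_zero]

theorem extRees_rightMul (N : GrMod.{u, u, u, k} ℬ) {α β γ β' γ' : G} (h : ε + β = γ)
    (h' : ε + β' = γ') (hβ : α + β = β') (hγ : α + γ = γ') (a : 𝒜 α) (n : ℕ)
    (x : Ext.{u + 1} N (GrMod.shift γ (GrMod.regular ℬ)) n) :
    Q.extRees N h' n (extRightMul ℬ N n hγ ⟨f a, Q.map_mem _ _ a.2⟩ x) =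
      extRightMul 𝒜 (Q.res.obj N) (n + 1) hβ ⟨σ.1 a, (σ.2 _ _).2 a.2⟩ (Q.extRees N h n x) := by
  refine extChange_comp_mk₀ Q.res (𝟙 (Q.res.obj N)) _ _ (GrMod.rightMul ℬ hγ _) _ ?_ rfl x
  refine ShortComplex.ShortExact.extClass_naturality (Q.mulSeq_shortExact h)
    (Q.mulSeq_shortExact h')
    { τ₁ := GrMod.rightMul 𝒜 hβ ⟨σ.1 a, (σ.2 _ _).2 a.2⟩
      τ₂ := GrMod.rightMul 𝒜 hγ a
      τ₃ := Q.res.map (GrMod.rightMul ℬ hγ ⟨f a, Q.map_mem _ _ a.2⟩)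
      comm₁₂ := ?_
      comm₂₃ := ?_ }
  · ext δ x
    refine Subtype.ext ?_
    change x.1 * σ.1 a.1 * z = x.1 * z * a.1
    rw [mul_assoc, mul_assoc, Q.comm]
  · ext δ x
    exact Subtype.ext (map_mul f _ _)

theorem extRes_comp_mk₀ {M : GrMod.{u, u, u, k} 𝒜} {N : GrMod.{u, u, u, k} ℬ}
    (η : M ⟶ Q.res.obj N) {N₁ N₂ : GrMod.{u, u, u, k} ℬ} (g : N₁ ⟶ N₂) (n : ℕ)
    (x : Ext.{u + 1} N N₁ n) :
    Q.extRes η N₂ n (x.comp (Ext.mk₀ g) (add_zero n)) =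
      (Q.extRes η N₁ n x).comp (Ext.mk₀ (Q.res.map g)) (add_zero n) :=
  extChange_comp_mk₀ Q.res η _ _ g _ (by rw [Ext.mk₀_id_comp, Ext.comp_mk₀_id]) _ x

/-- The map `Ext_A(M, Σ_γ A) → Ext_A(M, Σ_γ B)`. -/
noncomputable def extProj (M : GrMod.{u, u, u, k} 𝒜) (γ : G) (n : ℕ) :
    Ext.{u + 1} M (GrMod.shift γ (GrMod.regular 𝒜)) n →+
      Ext.{u + 1} M (Q.res.obj (GrMod.shift γ (GrMod.regular ℬ))) n :=
  (Ext.mk₀ (Q.shiftProj γ)).postcomp M (add_zero n)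

theorem extProj_rightMul (M : GrMod.{u, u, u, k} 𝒜) {α γ γ' : G} (h : α + γ = γ') (a : 𝒜 α)
    (n : ℕ) (x : Ext.{u + 1} M (GrMod.shift γ (GrMod.regular 𝒜)) n) :
    Q.extProj M γ' n (extRightMul 𝒜 M n h a x) =
      (Q.extProj M γ n x).comp
        (Ext.mk₀ (Q.res.map (GrMod.rightMul ℬ h ⟨f a, Q.map_mem _ _ a.2⟩))) (add_zero n) := by
  change (x.comp (Ext.mk₀ _) (add_zero n)).comp (Ext.mk₀ _) (add_zero n) =
    (x.comp (Ext.mk₀ _) (add_zero n)).comp (Ext.mk₀ _) (add_zero n)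
  rw [Ext.comp_assoc_of_third_deg_zero, Ext.comp_assoc_of_third_deg_zero, Ext.mk₀_comp_mk₀,
    Ext.mk₀_comp_mk₀]
  congr 2
  ext δ x
  exact Subtype.ext (map_mul f _ _)

theorem extProj_eq_zero_iff (M : GrMod.{u, u, u, k} 𝒜) {β γ : G} (h : ε + β = γ) (n : ℕ)
    (x : Ext.{u + 1} M (GrMod.shift γ (GrMod.regular 𝒜)) n) :
    Q.extProj M γ n x = 0 ↔ ∃ y, extRightMul 𝒜 M n h ⟨z, Q.mem⟩ y = x := by
  constructor
  · exact fun hx => Ext.covariant_sequence_exact₂ M (Q.mulSeq_shortExact h) x hx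
  · rintro ⟨y, rfl⟩
    change (y.comp (Ext.mk₀ (Q.mulSeq h).f) (add_zero n)).comp (Ext.mk₀ (Q.mulSeq h).g)
      (add_zero n) = 0
    rw [Ext.comp_assoc_of_third_deg_zero, Ext.mk₀_comp_mk₀, (Q.mulSeq h).zero, Ext.mk₀_zero,
      Ext.comp_zero]

theorem extProj_surjective (M : GrMod.{u, u, u, k} 𝒜) {β γ : G} (h : ε + β = γ) (n : ℕ)
    (hinj : Function.Injective (extRightMul 𝒜 M (n + 1) h ⟨z, Q.mem⟩)) :
    Function.Surjective (Q.extProj M γ n) := fun x => by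
  refine Ext.covariant_sequence_exact₃ M (Q.mulSeq_shortExact h) x rfl (hinj ?_)
  rw [map_zero]
  change (x.comp _ rfl).comp (Ext.mk₀ (Q.mulSeq h).f) (add_zero _) = 0
  rw [Ext.comp_assoc_of_third_deg_zero, (Q.mulSeq_shortExact h).extClass_comp, Ext.comp_zero]

end NormalQuotient

namespace NormalQuotient

open Abelian

variable {K : Type k} {G A B C : Type u} [Field K] [AddCommGroup G]
variable [Ring A] [Algebra K A] [Ring B] [Algebra K B] [Ring C] [Algebra K C]
variable {𝒜 : Grading K G A} [SetLike.GradedMonoid 𝒜]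
variable {ℬ : Grading K G B} [SetLike.GradedMonoid ℬ]
variable {𝒞 : Grading K G C} [SetLike.GradedMonoid 𝒞]
variable {f : A →ₐ[K] B} {z : A} {ε : G} {σ : gradedAut 𝒜} (Q : NormalQuotient 𝒜 ℬ f z ε σ)
variable {g : B →ₐ[K] C} {y : B} {ε' : G} {τ : gradedAut ℬ} (Q' : NormalQuotient ℬ 𝒞 g y ε' τ)
variable {M : GrMod.{u, u, u, k} 𝒜} {N : GrMod.{u, u, u, k} 𝒞}
variable {η : M ⟶ Q.res.obj (Q'.res.obj N)} (hη : Q.IsReduction η)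

include hη in
theorem exists_extRightMul_eq {β γ δ : G} (h : ε + β = γ) (h' : ε' + δ = γ) (n : ℕ) (a : 𝒜 ε')
    (ha : f a = y) (x : Ext.{u + 1} M (GrMod.shift δ (GrMod.regular 𝒜)) n) :
    ∃ x', extRightMul 𝒜 M n h ⟨z, Q.mem⟩ x' = extRightMul 𝒜 M n h' a x := by
  rw [← Q.extProj_eq_zero_iff, Q.extProj_rightMul]
  obtain ⟨t, ht⟩ := (hη.extRes_bijective Q (GrMod.shift δ (GrMod.regular ℬ)) n).2 (Q.extProj M δ n x)
  rw [← ht, ← Q.extRes_comp_mk₀]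
  subst ha
  exact (congrArg _ (Q'.extRightMul_self_eq_zero N h' n t)).trans (map_zero _)

/-- The comparison map `Ext^n_C(N, Σ_γ C) → Ext^{n + 1}_A(M, Σ_β B)`. -/
noncomputable def extTwo (η : M ⟶ Q.res.obj (Q'.res.obj N)) {β γ : G} (h : ε' + β = γ) (n : ℕ) :
    Ext.{u + 1} N (GrMod.shift γ (GrMod.regular 𝒞)) n →+
      Ext.{u + 1} M (Q.res.obj (GrMod.shift β (GrMod.regular ℬ))) (n + 1) :=
  (Q.extRes η _ (n + 1)).comp (Q'.extRees N h n)

include hη in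
theorem extTwo_bijective {β γ : G} (h : ε' + β = γ) (n : ℕ) :
    Function.Bijective (extTwo Q Q' η h n) :=
  (hη.extRes_bijective Q _ (n + 1)).comp (Q'.extRees_bijective h n N)

theorem extTwo_rightMul {α β γ β' γ' : G} (h : ε' + β = γ) (h' : ε' + β' = γ') (hβ : α + β = β')
    (hγ : α + γ = γ') (b : ℬ α) (n : ℕ) (x : Ext.{u + 1} N (GrMod.shift γ (GrMod.regular 𝒞)) n) :
    extTwo Q Q' η h' n (extRightMul 𝒞 N n hγ ⟨g b, Q'.map_mem _ _ b.2⟩ x) =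
      (extTwo Q Q' η h n x).comp
        (Ext.mk₀ (Q.res.map (GrMod.rightMul ℬ hβ ⟨τ.1 b, (τ.2 _ _).2 b.2⟩))) (add_zero _) := by
  change Q.extRes η _ (n + 1) (Q'.extRees N h' n _) = _
  rw [Q'.extRees_rightMul N h h' hβ hγ]
  exact Q.extRes_comp_mk₀ η _ _ _

include hη in
theorem subsingleton_ext_zero (β : G) :
    Subsingleton (Ext.{u + 1} M (Q.res.obj (GrMod.shift β (GrMod.regular ℬ))) 0) :=
  subsingleton_of_forall_eq 0 fun x => by
    obtain ⟨t, rfl⟩ := (hη.extRes_bijective Q _ 0).2 x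
    obtain ⟨t, rfl⟩ := (Ext.mk₀_bijective _ _).2 t
    obtain rfl : t = 0 := Q'.hom_regular_eq_zero t
    rw [Ext.mk₀_zero, map_zero]

end NormalQuotient

section Decomposition

variable {K : Type k} {G : Type w} {A B : Type u} [Field K] [AddCommGroup G]
variable [Ring A] [Algebra K A] [Ring B] [Algebra K B]

theorem hasDecomposition_of_gradedAlgebra [DecidableEq G] (𝒜 : Grading K G A) [GradedAlgebra 𝒜] :
    HasDecomposition 𝒜 := by
  refine ⟨⟨(DirectSum.toModule K G (G →₀ A)
    fun γ => (Finsupp.lsingle γ).comp (𝒜 γ).subtype).comp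
      (DirectSum.decomposeLinearEquiv 𝒜).toLinearMap, fun γ a ha => ?_⟩,
    (DirectSum.Decomposition.isInternal 𝒜).submodule_iSup_eq_top⟩
  change DirectSum.toModule K G (G →₀ A) _ (DirectSum.decompose 𝒜 a) = _
  rw [DirectSum.decompose_of_mem 𝒜 ha]
  exact DirectSum.toModule_lof K γ _

theorem HasDecomposition.op {𝒜 : Grading K G A} (hA : HasDecomposition 𝒜) :
    HasDecomposition (opGrading 𝒜) := by
  obtain ⟨D, hD⟩ := hA.1
  refine ⟨⟨(Finsupp.mapRange.linearMap (MulOpposite.opLinearEquiv K).toLinearMap).comp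
    (D.comp (MulOpposite.opLinearEquiv K).symm.toLinearMap), fun γ a ha => ?_⟩, ?_⟩
  · change Finsupp.mapRange.linearMap _ (D a.unop) = _
    rw [hD γ _ (mem_opGrading.1 ha)]
    simp
  · change ⨆ γ, (𝒜 γ).map _ = ⊤
    rw [← Submodule.map_iSup, hA.2, Submodule.map_top]
    exact LinearEquiv.range _

theorem HasDecomposition.tensor {𝒜 : Grading K G A} (hA : HasDecomposition 𝒜)
    {ℬ : Grading K G B} (hB : HasDecomposition ℬ) : HasDecomposition (tensorGrading 𝒜 ℬ) := by
  classical
  obtain ⟨D, hD⟩ := hA.1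
  obtain ⟨E, hE⟩ := hB.1
  refine ⟨⟨(Finsupp.lmapDomain (A ⊗[K] B) K fun p : G × G => p.1 + p.2).comp
    ((finsuppTensorFinsupp K K A B G G).toLinearMap.comp (TensorProduct.map D E)),
    fun γ t ht => ?_⟩, ?_⟩
  · induction ht using Submodule.span_induction with
    | zero => simp
    | add x y _ _ hx hy => rw [map_add, hx, hy, Finsupp.single_add]
    | smul c x _ hx => rw [map_smul, hx, Finsupp.smul_single]
    | mem x hx =>
      obtain ⟨α, β, rfl, a, ha, b, hb, rfl⟩ := hx
      simp [hD α a ha, hE β b hb, Finsupp.mapDomain_single]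
  · rw [eq_top_iff]
    rintro t -
    induction t using TensorProduct.induction_on with
    | zero => exact zero_mem _
    | add x y hx hy => exact add_mem hx hy
    | tmul a b =>
      refine hA.induction (p := fun a => a ⊗ₜ[K] b ∈ ⨆ γ, tensorGrading 𝒜 ℬ γ) ?_ ?_ ?_ a
      · rw [TensorProduct.zero_tmul]; exact zero_mem _
      · intro α a ha
        refine hB.induction (p := fun b => a ⊗ₜ[K] b ∈ ⨆ γ, tensorGrading 𝒜 ℬ γ) ?_ ?_ ?_ b
        · rw [TensorProduct.tmul_zero]; exact zero_mem _
        · exact fun β b hb => Submodule.mem_iSup_of_mem (α + β) (tmul_mem rfl ha hb)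
        · intro b b' h h'
          rw [TensorProduct.tmul_add]; exact add_mem h h'
      · intro a a' h h'
        rw [TensorProduct.add_tmul]; exact add_mem h h'

theorem NormalQuotient.hasDecomposition {𝒜 : Grading K G A} [SetLike.GradedMonoid 𝒜]
    {ℬ : Grading K G B} [SetLike.GradedMonoid ℬ] {f : A →ₐ[K] B} {z : A} {ε : G}
    {σ : gradedAut 𝒜} (Q : NormalQuotient 𝒜 ℬ f z ε σ) (hf : Function.Surjective f) : HasDecomposition ℬ := by
  obtain ⟨D, hD⟩ := Q.decomposition.1
  obtain ⟨s, hs⟩ := f.toLinearMap.exists_rightInverse_of_surjective (LinearMap.range_eq_top.2 hf)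
  refine ⟨⟨(Finsupp.mapRange.linearMap f.toLinearMap).comp (D.comp s), fun γ b hb => ?_⟩, ?_⟩
  · obtain ⟨a, ha, rfl⟩ := Q.exists_lift γ b hb
    obtain ⟨c, hc⟩ := (Q.map_eq_zero_iff (s (f a) - a)).1 (by
      rw [map_sub, sub_eq_zero]
      exact LinearMap.congr_fun hs (f a))
    change Finsupp.mapRange.linearMap f.toLinearMap (D (s (f a))) = _
    rw [sub_eq_iff_eq_add.1 hc, map_add D, map_add, hD γ a ha]
    ext δ
    have := Q.decomposition.apply_mul hD Q.mem c (δ - ε)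
    rw [add_sub_cancel] at this
    simp [this, Q.map_self]
  · rw [eq_top_iff]
    rintro b -
    obtain ⟨a, rfl⟩ := hf b
    refine Q.decomposition.induction (p := fun a => f a ∈ ⨆ γ, ℬ γ) ?_ ?_ ?_ a
    · rw [map_zero]; exact zero_mem _
    · exact fun γ a ha => Submodule.mem_iSup_of_mem γ (Q.map_mem γ a ha)
    · intro a a' h h'
      rw [map_add]; exact add_mem h h'

end Decomposition

section Constructions

variable {K : Type k} {G : Type w} {A B X Y : Type u} [Field K] [AddCommGroup G]
variable [Ring A] [Algebra K A] [Ring B] [Algebra K B] [Ring X] [Algebra K X]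
variable [Ring Y] [Algebra K Y]
variable {𝒜 : Grading K G A} {ℬ : Grading K G B} {𝒳 : Grading K G X} {𝒴 : Grading K G Y}

theorem tensorMap_mem {f : A →ₐ[K] B} (hf : ∀ γ a, a ∈ 𝒜 γ → f a ∈ ℬ γ) {g : X →ₐ[K] Y}
    (hg : ∀ γ a, a ∈ 𝒳 γ → g a ∈ 𝒴 γ) (γ : G) (t : A ⊗[K] X) (ht : t ∈ tensorGrading 𝒜 𝒳 γ) :
    Algebra.TensorProduct.map f g t ∈ tensorGrading ℬ 𝒴 γ := by
  induction ht using Submodule.span_induction with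
  | zero => rw [map_zero]; exact zero_mem _
  | add x y _ _ hx hy => rw [map_add]; exact add_mem hx hy
  | smul c x _ hx => rw [map_smul]; exact Submodule.smul_mem _ _ hx
  | mem x hx =>
    obtain ⟨α, β, rfl, a, ha, b, hb, rfl⟩ := hx
    exact tmul_mem rfl (hf _ _ ha) (hg _ _ hb)

theorem tensorMap_exists_lift {f : A →ₐ[K] B} (hf : ∀ γ, ∀ b ∈ ℬ γ, ∃ a ∈ 𝒜 γ, f a = b)
    {g : X →ₐ[K] Y} (hg : ∀ γ, ∀ b ∈ 𝒴 γ, ∃ a ∈ 𝒳 γ, g a = b) (γ : G) (t : B ⊗[K] Y)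
    (ht : t ∈ tensorGrading ℬ 𝒴 γ) :
    ∃ s ∈ tensorGrading 𝒜 𝒳 γ, Algebra.TensorProduct.map f g s = t := by
  induction ht using Submodule.span_induction with
  | zero => exact ⟨0, zero_mem _, map_zero _⟩
  | add x y _ _ hx hy =>
    obtain ⟨s, hs, rfl⟩ := hx
    obtain ⟨s', hs', rfl⟩ := hy
    exact ⟨s + s', add_mem hs hs', map_add _ _ _⟩
  | smul c x _ hx =>
    obtain ⟨s, hs, rfl⟩ := hx
    exact ⟨c • s, Submodule.smul_mem _ _ hs, map_smul _ _ _⟩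
  | mem x hx =>
    obtain ⟨α, β, rfl, b, hb, y, hy, rfl⟩ := hx
    obtain ⟨a, ha, rfl⟩ := hf _ _ hb
    obtain ⟨x, hx, rfl⟩ := hg _ _ hy
    exact ⟨a ⊗ₜ x, tmul_mem rfl ha hx, rfl⟩

/-- The automorphism `σ ⊗ τ` of a tensor product. -/
noncomputable def tensorAut (σ : gradedAut 𝒜) (τ : gradedAut 𝒳) :
    gradedAut (tensorGrading 𝒜 𝒳) :=
  ⟨Algebra.TensorProduct.congr σ.1 τ.1, fun γ t => by
    constructor
    · intro h
      have h' := tensorMap_mem (f := σ⁻¹.1.toAlgHom) (fun γ a => (σ⁻¹.2 γ a).2)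
        (g := τ⁻¹.1.toAlgHom) (fun γ a => (τ⁻¹.2 γ a).2) γ _ h
      have e : Algebra.TensorProduct.map (σ⁻¹).1.toAlgHom (τ⁻¹).1.toAlgHom
          (Algebra.TensorProduct.congr σ.1 τ.1 t) = t :=
        (Algebra.TensorProduct.congr σ.1 τ.1).symm_apply_apply t
      rwa [e] at h'
    · exact tensorMap_mem (f := σ.1.toAlgHom) (fun γ a => (σ.2 γ a).2)
        (g := τ.1.toAlgHom) (fun γ a => (τ.2 γ a).2) γ t⟩

@[simp] theorem tensorAut_tmul (σ : gradedAut 𝒜) (τ : gradedAut 𝒳) (a : A) (x : X) :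
    (tensorAut σ τ).1 (a ⊗ₜ x) = σ.1 a ⊗ₜ τ.1 x := rfl

/-- The automorphism of the opposite algebra defined by an automorphism. -/
def opAut (σ : gradedAut 𝒜) : gradedAut (opGrading 𝒜) :=
  ⟨AlgEquiv.op σ.1, fun γ a => by
    rw [mem_opGrading, mem_opGrading]
    exact σ.2 γ a.unop⟩

@[simp] theorem opAut_op (σ : gradedAut 𝒜) (a : A) :
    (opAut σ).1 (MulOpposite.op a) = MulOpposite.op (σ.1 a) := rfl

namespace NormalQuotient

variable {f : A →ₐ[K] B} {z : A} {ε : G} {σ : gradedAut 𝒜} (Q : NormalQuotient 𝒜 ℬ f z ε σ)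

include Q

theorem surjective (hB : HasDecomposition ℬ) : Function.Surjective f := fun b =>
  hB.induction (p := fun b => ∃ a, f a = b) ⟨0, map_zero f⟩
    (fun γ b hb => (Q.exists_lift γ b hb).imp fun _ h => h.2)
    (fun _ _ ⟨a, ha⟩ ⟨a', ha'⟩ => ⟨a + a', by rw [map_add, ha, ha']⟩) b

theorem mul_injective : Function.Injective (LinearMap.mulRight K z) := by
  rw [← LinearMap.ker_eq_bot, LinearMap.ker_eq_bot']
  exact Q.eq_zero_of_mul

theorem mul_exact : Function.Exact (LinearMap.mulRight K z) f.toLinearMap := fun a => by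
  rw [AlgHom.toLinearMap_apply, Q.map_eq_zero_iff]
  exact ⟨fun ⟨b, hb⟩ => ⟨b, hb.symm⟩, fun ⟨b, hb⟩ => ⟨b, hb.symm⟩⟩

theorem op [SetLike.GradedMonoid 𝒜] :
    NormalQuotient (opGrading 𝒜) (opGrading ℬ) (AlgHom.op f) (MulOpposite.op z) ε
      (opAut σ⁻¹) where
  decomposition := Q.decomposition.op
  mem := mem_opGrading.2 Q.mem
  comm a := by
    induction a using MulOpposite.rec' with
    | h a =>
      rw [opAut_op, ← MulOpposite.op_mul, ← MulOpposite.op_mul, Q.comm]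
      exact congrArg (fun t => MulOpposite.op (t * z)) (σ.1.apply_symm_apply a).symm
  eq_zero_of_mul a h := by
    induction a using MulOpposite.rec' with
    | h a =>
      rw [← MulOpposite.op_mul, MulOpposite.op_eq_zero_iff, Q.comm] at h
      rw [(EmbeddingLike.map_eq_zero_iff (f := σ.1)).1 (Q.eq_zero_of_mul _ h), MulOpposite.op_zero]
  map_mem γ a ha := mem_opGrading.2 (Q.map_mem γ _ (mem_opGrading.1 ha))
  exists_lift γ b hb := by
    obtain ⟨a, ha, e⟩ := Q.exists_lift γ b.unop (mem_opGrading.1 hb)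
    exact ⟨MulOpposite.op a, mem_opGrading.2 ha, congrArg MulOpposite.op e⟩
  map_eq_zero_iff a := by
    induction a using MulOpposite.rec' with
    | h a =>
      refine (MulOpposite.op_eq_zero_iff (f a)).trans ((Q.map_eq_zero_iff a).trans ⟨?_, ?_⟩)
      · rintro ⟨b, rfl⟩
        refine ⟨MulOpposite.op (σ.1.symm b), ?_⟩
        rw [← MulOpposite.op_mul, Q.comm, AlgEquiv.apply_symm_apply]
      · rintro ⟨b, hb⟩
        refine ⟨σ.1 b.unop, ?_⟩
        rw [← Q.comm]
        exact congrArg MulOpposite.unop hb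

theorem tensorLeft [SetLike.GradedMonoid 𝒳] (hB : HasDecomposition ℬ) (hX : HasDecomposition 𝒳) :
    NormalQuotient (tensorGrading 𝒜 𝒳) (tensorGrading ℬ 𝒳)
      (Algebra.TensorProduct.map f (AlgHom.id K X)) (z ⊗ₜ 1) ε (tensorAut σ 1) := by
  have e (t : A ⊗[K] X) : t * (z ⊗ₜ 1) = (LinearMap.mulRight K z).rTensor X t := by
    induction t using TensorProduct.induction_on with
    | zero => simp
    | add x y hx hy => rw [add_mul, hx, hy, map_add]
    | tmul a x => simp
  refine ⟨Q.decomposition.tensor hX, tmul_mem (add_zero ε) Q.mem SetLike.GradedOne.one_mem,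
    fun t => ?_, fun t ht => ?_, tensorMap_mem Q.map_mem fun _ _ h => h,
    tensorMap_exists_lift Q.exists_lift fun γ b hb => ⟨b, hb, rfl⟩, fun t => ?_⟩
  · induction t using TensorProduct.induction_on with
    | zero => simp
    | add x y hx hy => rw [mul_add, hx, hy, map_add, add_mul]
    | tmul a x =>
      rw [tensorAut_tmul, Algebra.TensorProduct.tmul_mul_tmul,
        Algebra.TensorProduct.tmul_mul_tmul, Q.comm, one_mul, mul_one]
      rfl
  · rw [e] at ht
    exact Module.Flat.rTensor_preserves_injective_linearMap _ Q.mul_injective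
      (ht.trans (map_zero _).symm)
  · have h := rTensor_exact X Q.mul_exact (Q.surjective hB) t
    refine Iff.trans h ⟨fun ⟨s, hs⟩ => ⟨s, ?_⟩, fun ⟨s, hs⟩ => ⟨s, ?_⟩⟩
    · rw [e, hs]
    · rw [← e, hs]

theorem tensorRight [SetLike.GradedMonoid 𝒳] (hB : HasDecomposition ℬ) (hX : HasDecomposition 𝒳) :
    NormalQuotient (tensorGrading 𝒳 𝒜) (tensorGrading 𝒳 ℬ)
      (Algebra.TensorProduct.map (AlgHom.id K X) f) (1 ⊗ₜ z) ε (tensorAut 1 σ) := by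
  have e (t : X ⊗[K] A) : t * (1 ⊗ₜ z) = (LinearMap.mulRight K z).lTensor X t := by
    induction t using TensorProduct.induction_on with
    | zero => simp
    | add x y hx hy => rw [add_mul, hx, hy, map_add]
    | tmul a x => simp
  refine ⟨hX.tensor Q.decomposition, tmul_mem (zero_add ε) SetLike.GradedOne.one_mem Q.mem,
    fun t => ?_, fun t ht => ?_, tensorMap_mem (fun _ _ h => h) Q.map_mem,
    tensorMap_exists_lift (fun γ b hb => ⟨b, hb, rfl⟩) Q.exists_lift, fun t => ?_⟩
  · induction t using TensorProduct.induction_on with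
    | zero => simp
    | add x y hx hy => rw [mul_add, hx, hy, map_add, add_mul]
    | tmul a x =>
      rw [tensorAut_tmul, Algebra.TensorProduct.tmul_mul_tmul,
        Algebra.TensorProduct.tmul_mul_tmul, Q.comm, one_mul, mul_one]
      rfl
  · rw [e] at ht
    exact Module.Flat.lTensor_preserves_injective_linearMap _ Q.mul_injective
      (ht.trans (map_zero _).symm)
  · have h := lTensor_exact X Q.mul_exact (Q.surjective hB) t
    refine Iff.trans h ⟨fun ⟨s, hs⟩ => ⟨s, ?_⟩, fun ⟨s, hs⟩ => ⟨s, ?_⟩⟩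
    · rw [e, hs]
    · rw [← e, hs]

end NormalQuotient

end Constructions

section QuotAlg

variable {K : Type k} {G : Type w} {A : Type u} [Field K] [AddCommGroup G] [Ring A] [Algebra K A]

theorem quotMk_eq_zero_iff {z : A} (hz : IsNormalElement z) (a : A) :
    quotMk K z a = 0 ↔ ∃ b, a = b * z := by
  have h₁ : quotMk K z a = 0 ↔ a ∈ TwoSidedIdeal.span {z} := by
    rw [TwoSidedIdeal.mem_iff, ← RingCon.eq]
    rfl
  rw [h₁]
  constructor
  · intro h
    let I : TwoSidedIdeal A := TwoSidedIdeal.mk' {a | ∃ b, a = b * z} ⟨0, (zero_mul z).symm⟩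
      (by rintro _ _ ⟨b, rfl⟩ ⟨c, rfl⟩; exact ⟨b + c, (add_mul _ _ _).symm⟩)
      (by rintro _ ⟨b, rfl⟩; exact ⟨-b, (neg_mul _ _).symm⟩)
      (by rintro x _ ⟨b, rfl⟩; exact ⟨x * b, (mul_assoc _ _ _).symm⟩)
      (by
        rintro _ y ⟨b, rfl⟩
        obtain ⟨c, hc⟩ := hz.subset ⟨y, rfl⟩
        exact ⟨b * c, by rw [mul_assoc, mul_assoc]; exact congrArg (b * ·) hc.symm⟩)
    have hI : TwoSidedIdeal.span {z} ≤ I := TwoSidedIdeal.span_le.2 (by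
      rw [Set.singleton_subset_iff, SetLike.mem_coe]
      exact (TwoSidedIdeal.mem_mk' _ _ _ _ _ _ _).2 ⟨1, (one_mul z).symm⟩)
    have h' : a ∈ {a | ∃ b, a = b * z} := (TwoSidedIdeal.mem_mk' _ _ _ _ _ _ _).1 (hI h)
    exact h'
  · rintro ⟨b, rfl⟩
    exact TwoSidedIdeal.mul_mem_left _ _ _ (TwoSidedIdeal.subset_span rfl)

/-- A regular normal homogeneous element induces an automorphism. -/
theorem exists_normalizing_aut {𝒜 : Grading K G A} [SetLike.GradedMonoid 𝒜]
    (hA : HasDecomposition 𝒜) {z : A} {ε : G} (hz : z ∈ 𝒜 ε) (hreg : IsRegular z)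
    (hnormal : IsNormalElement z) : ∃ σ : gradedAut 𝒜, ∀ a, z * a = σ.1 a * z := by
  choose s hs using fun a : A => hnormal.subset ⟨a, rfl⟩
  choose t ht using fun a : A => hnormal.superset ⟨a, rfl⟩
  simp only at hs ht
  have hr {a b : A} (h : a * z = b * z) : a = b := hreg.right h
  have hl {a b : A} (h : z * a = z * b) : a = b := hreg.left h
  let e : A ≃ₐ[K] A := AlgEquiv.ofBijective
    { toFun := s
      map_one' := hr (by rw [hs, mul_one, one_mul])
      map_mul' := fun a b => hr (by rw [hs, ← mul_assoc, ← hs a, mul_assoc, ← hs b, mul_assoc])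
      map_zero' := hr (by rw [hs, mul_zero, zero_mul])
      map_add' := fun a b => hr (by rw [hs, mul_add, add_mul, hs, hs])
      commutes' := fun c => hr (by rw [hs, Algebra.commutes]) }
    ⟨fun a b h => hl (by rw [← hs, ← hs]; exact congrArg (· * z) h),
      fun a => ⟨t a, hr (by
        change s (t a) * z = a * z
        rw [hs, ht])⟩⟩
  have he (a : A) : z * a = e a * z := (hs a).symm
  refine ⟨⟨e, fun γ a => ⟨fun h => ?_, fun h => ?_⟩⟩, he⟩
  · have hop := hA.op.mem_of_mul_mem (z := MulOpposite.op z) (mem_opGrading.2 hz)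
      (fun b hb => MulOpposite.unop_injective (hl (by
        rw [MulOpposite.unop_zero, mul_zero]; exact congrArg MulOpposite.unop hb)))
      (rfl : ε + γ = ε + γ) (a := MulOpposite.op a) (mem_opGrading.2 (by
        change z * a ∈ 𝒜 (ε + γ)
        rw [he, add_comm]
        exact SetLike.GradedMul.mul_mem h hz))
    exact mem_opGrading.1 hop
  · refine hA.mem_of_mul_mem hz (fun b hb => hr (by rw [hb, zero_mul])) (rfl : ε + γ = ε + γ) ?_
    rw [← he]
    exact SetLike.GradedMul.mul_mem hz h

theorem quotMk_surjective (z : A) : Function.Surjective (quotMk K z) :=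
  RingCon.mk'_surjective _

theorem normalQuotient_quotMk {𝒜 : Grading K G A} [SetLike.GradedMonoid 𝒜]
    (hA : HasDecomposition 𝒜) {z : A} {ε : G} (hz : z ∈ 𝒜 ε) (hreg : IsRegular z)
    (hnormal : IsNormalElement z) (σ : gradedAut 𝒜) (hσ : ∀ a, z * a = σ.1 a * z) :
    NormalQuotient 𝒜 (quotGrading 𝒜 z) (quotMk K z) z ε σ where
  decomposition := hA
  mem := hz
  comm := hσ
  eq_zero_of_mul a h := hreg.right (by simpa using h)
  map_mem _ a ha := ⟨a, ha, rfl⟩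
  exists_lift _ _ hb := hb
  map_eq_zero_iff := quotMk_eq_zero_iff hnormal

end QuotAlg

open Abelian

/-- Two surjections with the same kernel identify their targets. -/
noncomputable def addEquivOfSurjective {U V W : Type*} [AddCommGroup U] [AddCommGroup V]
    [AddCommGroup W] (t : U →+ V) (p : U →+ W) (ht : Function.Surjective t)
    (hp : Function.Surjective p) (h : ∀ u, t u = 0 ↔ p u = 0) : V ≃+ W :=
  (QuotientAddGroup.quotientKerEquivOfSurjective t ht).symm.trans
    ((QuotientAddGroup.quotientAddEquivOfEq (AddSubgroup.ext h)).trans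
      (QuotientAddGroup.quotientKerEquivOfSurjective p hp))

theorem addEquivOfSurjective_apply {U V W : Type*} [AddCommGroup U] [AddCommGroup V]
    [AddCommGroup W] (t : U →+ V) (p : U →+ W) (ht : Function.Surjective t)
    (hp : Function.Surjective p) (h : ∀ u, t u = 0 ↔ p u = 0) (u : U) :
    addEquivOfSurjective t p ht hp h (t u) = p u := by
  have e : (QuotientAddGroup.quotientKerEquivOfSurjective t ht).symm (t u) = (u : U ⧸ t.ker) :=
    (AddEquiv.symm_apply_eq _).2 rfl
  simp only [addEquivOfSurjective, AddEquiv.trans_apply, e]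
  rfl

section Bimodules

variable {K : Type k} {G A B : Type u} [Field K] [AddCommGroup G]
variable [Ring A] [Algebra K A] [Ring B] [Algebra K B]

/-- The homomorphism of enveloping algebras defined by a homomorphism. -/
noncomputable abbrev envHom (f : A →ₐ[K] B) : A ⊗[K] Aᵐᵒᵖ →ₐ[K] B ⊗[K] Bᵐᵒᵖ :=
  Algebra.TensorProduct.map f (AlgHom.op f)

theorem map_mulLeftRight (f : A →ₐ[K] B) (s : A ⊗[K] Aᵐᵒᵖ) (m : A) :
    f (AlgHom.mulLeftRight K A s m) = AlgHom.mulLeftRight K B (envHom f s) (f m) := by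
  induction s using TensorProduct.induction_on with
  | zero => simp
  | add x y hx hy => simp only [map_add, LinearMap.add_apply, hx, hy]
  | tmul a b => simp [AlgHom.mulLeftRight_apply]

theorem envHom_envSwap (f : A →ₐ[K] B) (s : A ⊗[K] Aᵐᵒᵖ) :
    envHom f (envSwap K A s) = envSwap K B (envHom f s) := by
  induction s using TensorProduct.induction_on with
  | zero => simp
  | add x y hx hy => simp only [map_add, hx, hy]
  | tmul a b => simp

variable {𝒜 : Grading K G A} [SetLike.GradedMonoid 𝒜] {ℬ : Grading K G B} [SetLike.GradedMonoid ℬ]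

theorem envSwap_envMap_one (τ : gradedAut 𝒜) (s : A ⊗[K] Aᵐᵒᵖ) :
    envSwap K A (envMap (1 : gradedAut 𝒜).1 τ.1 s) =
      (tensorAut τ (1 : gradedAut (opGrading 𝒜))).1 (envSwap K A s) := by
  induction s using TensorProduct.induction_on with
  | zero => simp
  | add x y hx hy => simp only [map_add, hx, hy]
  | tmul a b => rfl

theorem envHom_envMap {f : A →ₐ[K] B} {μ τ : gradedAut 𝒜} {μ' τ' : gradedAut ℬ}
    (hμ : ∀ a, μ'.1 (f a) = f (μ.1 a)) (hτ : ∀ a, τ'.1 (f a) = f (τ.1 a)) (s : A ⊗[K] Aᵐᵒᵖ) :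
    envHom f (envMap (1 : gradedAut 𝒜).1 μ.1 (envMap (1 : gradedAut 𝒜).1 τ.1 s)) =
      envMap (1 : gradedAut ℬ).1 (μ' * τ').1 (envHom f s) := by
  induction s using TensorProduct.induction_on with
  | zero => simp
  | add x y hx hy => simp only [map_add, hx, hy]
  | tmul a b =>
    change f a ⊗ₜ[K] MulOpposite.op (f (μ.1 (τ.1 b.unop))) =
      f a ⊗ₜ[K] MulOpposite.op (μ'.1 (τ'.1 (f b.unop)))
    rw [hτ, hμ]

/-- An automorphism which preserves the kernel of `f : A → B` induces an automorphism of `B`. -/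
theorem exists_induced_aut {f : A →ₐ[K] B} (hf : Function.Surjective f)
    (hf₁ : ∀ γ a, a ∈ 𝒜 γ → f a ∈ ℬ γ) (hf₂ : ∀ γ, ∀ b ∈ ℬ γ, ∃ a ∈ 𝒜 γ, f a = b)
    (σ : gradedAut 𝒜) (hσ : ∀ a, f (σ.1 a) = 0 ↔ f a = 0) :
    ∃ σ' : gradedAut ℬ, ∀ a, σ'.1 (f a) = f (σ.1 a) := by
  choose s hs using hf
  have key (a : A) : f (σ.1 (s (f a))) = f (σ.1 a) := by
    rw [← sub_eq_zero, ← map_sub, ← map_sub, hσ, map_sub, hs, sub_self]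
  let e : B ≃ₐ[K] B := AlgEquiv.ofBijective
    { toFun := fun b => f (σ.1 (s b))
      map_one' := by rw [← map_one f, key, map_one]
      map_mul' := fun a b => by
        conv_lhs => rw [← hs a, ← hs b, ← map_mul, key]
        rw [map_mul, map_mul]
      map_zero' := by rw [← map_zero f, key, map_zero]
      map_add' := fun a b => by
        conv_lhs => rw [← hs a, ← hs b, ← map_add, key]
        rw [map_add, map_add]
      commutes' := fun c => by rw [← f.commutes, key, AlgEquiv.commutes] }
    ⟨fun a b h => by
      have h' : f (σ.1 (s a - s b)) = 0 := by
        rw [map_sub, map_sub, sub_eq_zero]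
        exact h
      rwa [hσ, map_sub, hs, hs, sub_eq_zero] at h',
    fun b => ⟨f (σ.1.symm (s b)), by
      change f (σ.1 (s (f _))) = b
      rw [key, AlgEquiv.apply_symm_apply, hs]⟩⟩
  have he (a : A) : e (f a) = f (σ.1 a) := key a
  refine ⟨⟨e, fun γ b => ⟨fun hb => ?_, fun hb => ?_⟩⟩, he⟩
  · obtain ⟨c, hc, hcb⟩ := hf₂ γ _ hb
    have : e (f (σ.1.symm c)) = e b := by rw [he, AlgEquiv.apply_symm_apply, hcb]
    rw [← e.injective this]
    refine hf₁ _ _ ?_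
    rw [← σ.2, AlgEquiv.apply_symm_apply]
    exact hc
  · obtain ⟨c, hc, rfl⟩ := hf₂ γ _ hb
    rw [he]
    exact hf₁ _ _ ((σ.2 _ _).2 hc)

/-- A homomorphism `A → B` as a morphism of graded modules over the enveloping algebra of `A`,
where this algebra acts on `B` through an algebra `X`. -/
def bimodMap {X : Type u} [Ring X] [Algebra K X] {𝒳 : Grading K G X} [SetLike.GradedMonoid 𝒳]
    {f : A →ₐ[K] B} (hf : ∀ γ a, a ∈ 𝒜 γ → f a ∈ ℬ γ) {g : A ⊗[K] Aᵐᵒᵖ →ₐ[K] X}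
    (hg : ∀ γ a, a ∈ envGrading 𝒜 γ → g a ∈ 𝒳 γ) {g' : X →ₐ[K] B ⊗[K] Bᵐᵒᵖ}
    (hg' : ∀ γ a, a ∈ 𝒳 γ → g' a ∈ envGrading ℬ γ) (h : ∀ s, g' (g s) = envHom f s) :
    bimod 𝒜 ⟶ (GrMod.restrictFunctor g hg).obj ((GrMod.restrictFunctor g' hg').obj (bimod ℬ)) where
  app γ :=
    { toFun := fun a => ⟨f a.1, hf _ _ a.2⟩
      map_zero' := Subtype.ext (map_zero f)
      map_add' := fun _ _ => Subtype.ext (map_add f _ _) }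
  map_act {α β γ} e s m := Subtype.ext <| by
    change f (AlgHom.mulLeftRight K A s.1 m.1) = AlgHom.mulLeftRight K B (g' (g s.1)) (f m.1)
    rw [h, map_mulLeftRight]

theorem map_comp_right_left (f : A →ₐ[K] B) (s : A ⊗[K] Aᵐᵒᵖ) :
    Algebra.TensorProduct.map f (AlgHom.id K Bᵐᵒᵖ)
      (Algebra.TensorProduct.map (AlgHom.id K A) (AlgHom.op f) s) = envHom f s := by
  induction s using TensorProduct.induction_on with
  | zero => simp
  | add x y hx hy => simp only [map_add, hx, hy]
  | tmul a b => rfl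

theorem map_comp_left_right (f : A →ₐ[K] B) (s : A ⊗[K] Aᵐᵒᵖ) :
    Algebra.TensorProduct.map (AlgHom.id K B) (AlgHom.op f)
      (Algebra.TensorProduct.map f (AlgHom.id K Aᵐᵒᵖ) s) = envHom f s := by
  induction s using TensorProduct.induction_on with
  | zero => simp
  | add x y hx hy => simp only [map_add, hx, hy]
  | tmul a b => rfl

namespace NormalQuotient

variable {f : A →ₐ[K] B} {z : A} {ε : G} {τ : gradedAut 𝒜} (Q : NormalQuotient 𝒜 ℬ f z ε τ)
variable (hB : HasDecomposition ℬ)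

include Q hB

theorem envRight : NormalQuotient (envGrading 𝒜) (tensorGrading 𝒜 (opGrading ℬ))
    (Algebra.TensorProduct.map (AlgHom.id K A) (AlgHom.op f)) (1 ⊗ₜ MulOpposite.op z) ε
    (tensorAut 1 (opAut τ⁻¹)) :=
  Q.op.tensorRight hB.op Q.decomposition

theorem envRightLeft : NormalQuotient (tensorGrading 𝒜 (opGrading ℬ)) (envGrading ℬ)
    (Algebra.TensorProduct.map f (AlgHom.id K Bᵐᵒᵖ)) (z ⊗ₜ 1) ε (tensorAut τ 1) :=
  Q.tensorLeft hB hB.op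

theorem envLeft : NormalQuotient (envGrading 𝒜) (tensorGrading ℬ (opGrading 𝒜))
    (Algebra.TensorProduct.map f (AlgHom.id K Aᵐᵒᵖ)) (z ⊗ₜ 1) ε (tensorAut τ 1) :=
  Q.tensorLeft hB Q.decomposition.op

theorem envLeftRight : NormalQuotient (tensorGrading ℬ (opGrading 𝒜)) (envGrading ℬ)
    (Algebra.TensorProduct.map (AlgHom.id K B) (AlgHom.op f)) (1 ⊗ₜ MulOpposite.op z) ε
    (tensorAut 1 (opAut τ⁻¹)) :=
  Q.op.tensorRight hB.op hB

theorem isReduction_right : (Q.envRight hB).IsReduction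
    (bimodMap Q.map_mem (Q.envRight hB).map_mem (Q.envRightLeft hB).map_mem
      (map_comp_right_left f)) where
  eq_zero_of_act h m hm := Subtype.ext <| Q.eq_zero_of_mul _ <| by
    have := congrArg Subtype.val hm
    change AlgHom.mulLeftRight K A (1 ⊗ₜ MulOpposite.op z) m.1 = 0 at this
    rwa [AlgHom.mulLeftRight_apply, one_mul] at this
  surjective γ b := by
    obtain ⟨a, ha, e⟩ := Q.exists_lift γ b.1 b.2
    exact ⟨⟨a, ha⟩, Subtype.ext e⟩
  exists_act_eq h m hm := by
    obtain ⟨b, hb, e⟩ := Q.exists_mul_eq h m.2 (congrArg Subtype.val hm)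
    refine ⟨⟨b, hb⟩, Subtype.ext ?_⟩
    change AlgHom.mulLeftRight K A (1 ⊗ₜ MulOpposite.op z) b = m.1
    rw [AlgHom.mulLeftRight_apply, one_mul, e]
    rfl

theorem isReduction_left : (Q.envLeft hB).IsReduction
    (bimodMap Q.map_mem (Q.envLeft hB).map_mem (Q.envLeftRight hB).map_mem
      (map_comp_left_right f)) where
  eq_zero_of_act h m hm := Subtype.ext <| Q.eq_zero_of_self_mul _ <| by
    have := congrArg Subtype.val hm
    change AlgHom.mulLeftRight K A (z ⊗ₜ 1) m.1 = 0 at this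
    rwa [AlgHom.mulLeftRight_apply, MulOpposite.unop_one, mul_one] at this
  surjective γ b := by
    obtain ⟨a, ha, e⟩ := Q.exists_lift γ b.1 b.2
    exact ⟨⟨a, ha⟩, Subtype.ext e⟩
  exists_act_eq h m hm := by
    obtain ⟨b, hb, e⟩ := Q.exists_mul_eq h m.2 (congrArg Subtype.val hm)
    refine ⟨⟨τ.1.symm b, Q.aut_symm_mem hb⟩, Subtype.ext ?_⟩
    change AlgHom.mulLeftRight K A (z ⊗ₜ 1) (τ.1.symm b) = m.1
    rw [AlgHom.mulLeftRight_apply, MulOpposite.unop_one, mul_one, e, Q.comm,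
      AlgEquiv.apply_symm_apply]

end NormalQuotient

end Bimodules

section CalabiYau

variable {K : Type k} {G A B : Type u} [Field K] [AddCommGroup G]
variable [Ring A] [Algebra K A] [Ring B] [Algebra K B]
variable {𝒜 : Grading K G A} [SetLike.GradedMonoid 𝒜] {ℬ : Grading K G B} [SetLike.GradedMonoid ℬ]
variable {d : ℕ} {l : G} {μ : gradedAut 𝒜}
variable (E : GrMod.Equiv (extBimod 𝒜 d) (GrMod.shift l (twist 1 μ (bimod 𝒜))))

/-- The identification of `Ext^d` with the algebra, in degree `γ`. -/
def cyEquiv (γ : G) : Ext.{u + 1} (bimod 𝒜) (GrMod.shift γ (GrMod.regular (envGrading 𝒜))) d ≃+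
    𝒜 (l + γ) :=
  E.app γ

theorem cyEquiv_rightMul {α β γ : G} (h : α + β = γ) (s t : envGrading 𝒜 α)
    (hst : t.1 = envSwap K A s.1)
    (u : Ext.{u + 1} (bimod 𝒜) (GrMod.shift β (GrMod.regular (envGrading 𝒜))) d) :
    (cyEquiv E γ (extRightMul (envGrading 𝒜) (bimod 𝒜) d h t u)).1 =
      AlgHom.mulLeftRight K A (envMap (1 : gradedAut 𝒜).1 μ.1 s.1) (cyEquiv E β u).1 := by
  obtain rfl : t = ⟨envSwap K A s.1, envSwap_mem s.2⟩ := Subtype.ext hst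
  exact congrArg Subtype.val (E.map_act h s u)

variable {f : A →ₐ[K] B} {z : A} {ε : G} {τ : gradedAut 𝒜} (Q : NormalQuotient 𝒜 ℬ f z ε τ)
variable (hB : HasDecomposition ℬ)

theorem cyEquiv_rightMul_right {β γ : G} (h : ε + β = γ)
    (u : Ext.{u + 1} (bimod 𝒜) (GrMod.shift β (GrMod.regular (envGrading 𝒜))) d) :
    (cyEquiv E γ (extRightMul (envGrading 𝒜) (bimod 𝒜) d h ⟨1 ⊗ₜ MulOpposite.op z,
      (Q.envRight hB).mem⟩ u)).1 = z * (cyEquiv E β u).1 := by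
  rw [cyEquiv_rightMul E h ⟨z ⊗ₜ 1, (Q.envLeft hB).mem⟩ ⟨1 ⊗ₜ MulOpposite.op z,
    (Q.envRight hB).mem⟩ rfl]
  change AlgHom.mulLeftRight K A (z ⊗ₜ MulOpposite.op (μ.1 1)) _ = _
  rw [AlgHom.mulLeftRight_apply, map_one, MulOpposite.unop_op, mul_one]

theorem cyEquiv_rightMul_left {β γ : G} (h : ε + β = γ)
    (u : Ext.{u + 1} (bimod 𝒜) (GrMod.shift β (GrMod.regular (envGrading 𝒜))) d) :
    (cyEquiv E γ (extRightMul (envGrading 𝒜) (bimod 𝒜) d h ⟨z ⊗ₜ 1,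
      (Q.envLeft hB).mem⟩ u)).1 = (cyEquiv E β u).1 * μ.1 z := by
  rw [cyEquiv_rightMul E h ⟨1 ⊗ₜ MulOpposite.op z, (Q.envRight hB).mem⟩ ⟨z ⊗ₜ 1,
    (Q.envLeft hB).mem⟩ rfl]
  change AlgHom.mulLeftRight K A (1 ⊗ₜ MulOpposite.op (μ.1 z)) _ = _
  rw [AlgHom.mulLeftRight_apply, one_mul, MulOpposite.unop_op]

/-- The generator of `Ext^d`. -/
theorem exists_cyEquiv_eq_one : ∃ γ, ∃ u, (cyEquiv E γ u).1 = 1 := by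
  have h1 : (1 : A) ∈ 𝒜 (l + -l) := by
    rw [add_neg_cancel]
    exact SetLike.GradedOne.one_mem
  exact ⟨-l, (cyEquiv E (-l)).symm ⟨1, h1⟩, by rw [AddEquiv.apply_symm_apply]⟩

include E Q hB

theorem exists_aut_self_eq_mul : ∃ r, μ.1 z = z * r := by
  obtain ⟨γ, u, hu⟩ := exists_cyEquiv_eq_one E
  obtain ⟨v, hv⟩ := NormalQuotient.exists_extRightMul_eq (Q.envRight hB) (Q.envRightLeft hB)
    (Q.isReduction_right hB) rfl rfl d ⟨z ⊗ₜ 1, (Q.envLeft hB).mem⟩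
    (Algebra.TensorProduct.map_tmul _ _ _ _ |>.trans (by rw [map_one]; rfl)) u
  have := congrArg (fun t => (cyEquiv E _ t).1) hv
  simp only [cyEquiv_rightMul_right E Q hB, cyEquiv_rightMul_left E Q hB, hu, one_mul] at this
  exact ⟨_, this.symm⟩

theorem exists_self_eq_mul_aut : ∃ r, z = r * μ.1 z := by
  obtain ⟨γ, u, hu⟩ := exists_cyEquiv_eq_one E
  obtain ⟨v, hv⟩ := NormalQuotient.exists_extRightMul_eq (Q.envLeft hB) (Q.envLeftRight hB)
    (Q.isReduction_left hB) rfl rfl d ⟨1 ⊗ₜ MulOpposite.op z, (Q.envRight hB).mem⟩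
    (Algebra.TensorProduct.map_tmul _ _ _ _ |>.trans (by rw [map_one]; rfl)) u
  have := congrArg (fun t => (cyEquiv E _ t).1) hv
  simp only [cyEquiv_rightMul_right E Q hB, cyEquiv_rightMul_left E Q hB, hu, mul_one] at this
  exact ⟨_, this.symm⟩

theorem map_aut_eq_zero_iff (a : A) : f (μ.1 a) = 0 ↔ f a = 0 := by
  obtain ⟨r, hr⟩ := exists_aut_self_eq_mul E Q hB
  obtain ⟨s, hs⟩ := exists_self_eq_mul_aut E Q hB
  constructor
  · intro h
    obtain ⟨b, hb⟩ := (Q.map_eq_zero_iff _).1 h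
    refine (Q.map_eq_zero_iff _).2 ⟨μ.1.symm (b * s), μ.1.injective ?_⟩
    rw [map_mul, AlgEquiv.apply_symm_apply, mul_assoc, ← hs, hb]
  · intro h
    obtain ⟨b, rfl⟩ := (Q.map_eq_zero_iff _).1 h
    rw [map_mul, hr, map_mul, map_mul, Q.map_self, zero_mul, mul_zero]

end CalabiYau

section QuotientCalabiYau

variable {K : Type k} {G A B : Type u} [Field K] [AddCommGroup G]
variable [Ring A] [Algebra K A] [Ring B] [Algebra K B]
variable {𝒜 : Grading K G A} [SetLike.GradedMonoid 𝒜] {ℬ : Grading K G B} [SetLike.GradedMonoid ℬ]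
variable {d : ℕ} {l : G} {μ : gradedAut 𝒜}
variable (hvanish : ∀ i : ℕ, i ≠ d → (extBimod 𝒜 i).IsZeroModule)
variable (E : GrMod.Equiv (extBimod 𝒜 d) (GrMod.shift l (twist 1 μ (bimod 𝒜))))
variable {f : A →ₐ[K] B} {z : A} {ε : G} {τ : gradedAut 𝒜} (Q : NormalQuotient 𝒜 ℬ f z ε τ)
variable (hB : HasDecomposition ℬ)

include hvanish E in
theorem extRightMul_right_injective {β γ : G} (h : ε + β = γ) (n : ℕ) :
    Function.Injective (extRightMul (envGrading 𝒜) (bimod 𝒜) n h ⟨1 ⊗ₜ MulOpposite.op z,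
      (Q.envRight hB).mem⟩) := by
  by_cases hn : n = d
  · subst hn
    rw [injective_iff_map_eq_zero]
    intro u hu
    apply (cyEquiv E β).injective
    rw [map_zero]
    refine Subtype.ext (Q.eq_zero_of_self_mul _ ?_)
    rw [← cyEquiv_rightMul_right E Q hB h, hu, map_zero]
    rfl
  · intro u v _
    exact (hvanish n hn β).elim u v

include hvanish E in
theorem extProj_right_surjective (γ : G) (n : ℕ) :
    Function.Surjective ((Q.envRight hB).extProj (bimod 𝒜) γ n) :=
  (Q.envRight hB).extProj_surjective _ (add_sub_cancel ε γ) n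
    (extRightMul_right_injective hvanish E Q hB _ _)

include E Q hB in
theorem one_le_of_not_isUnit (hz : ¬ IsUnit z) : 1 ≤ d := by
  rcases Nat.eq_zero_or_pos d with rfl | hd
  · exfalso
    obtain ⟨γ, u, hu⟩ := exists_cyEquiv_eq_one E
    have := NormalQuotient.subsingleton_ext_zero (Q.envRight hB) (Q.envRightLeft hB)
      (Q.isReduction_right hB) γ
    obtain ⟨v, hv⟩ := ((Q.envRight hB).extProj_eq_zero_iff (bimod 𝒜) (add_sub_cancel ε γ) 0 u).1
      (Subsingleton.elim _ _)
    have h₁ := congrArg (fun t => (cyEquiv E _ t).1) hv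
    simp only [cyEquiv_rightMul_right E Q hB, hu] at h₁
    refine hz ⟨⟨z, _, h₁, ?_⟩, rfl⟩
    rw [← sub_eq_zero]
    apply Q.eq_zero_of_self_mul
    rw [mul_sub, ← mul_assoc, h₁, one_mul, mul_one, sub_self]
  · exact hd

include hvanish E Q hB in
theorem extBimod_quotient_isZeroModule (i : ℕ) (hi : i + 1 ≠ d) :
    (extBimod ℬ i).IsZeroModule := fun γ => by
  have h₁ := extProj_right_surjective hvanish E Q hB (γ - ε) (i + 1)
  have h₂ := (NormalQuotient.extTwo_bijective (Q.envRight hB) (Q.envRightLeft hB)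
    (Q.isReduction_right hB) (add_sub_cancel ε γ) i).1
  have := hvanish (i + 1) hi (γ - ε)
  have : Subsingleton (Ext.{u + 1} (bimod 𝒜) ((Q.envRight hB).res.obj
      (GrMod.shift (γ - ε) (GrMod.regular (tensorGrading 𝒜 (opGrading ℬ))))) (i + 1)) :=
    @Function.Surjective.subsingleton _ _ _ this h₁
  exact h₂.subsingleton

variable {n : ℕ} (E' : GrMod.Equiv (extBimod 𝒜 (n + 1)) (GrMod.shift l (twist 1 μ (bimod 𝒜))))
variable (hvanish' : ∀ i : ℕ, i ≠ n + 1 → (extBimod 𝒜 i).IsZeroModule)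

/-- The isomorphism `Ext^n(B, Σ_γ B^e) ≃ Ext^{n + 1}(A, Σ_{γ - ε} (A ⊗ B^o))`. -/
noncomputable def extTwoEquiv (n : ℕ) (γ : G) :
    Ext.{u + 1} (bimod ℬ) (GrMod.shift γ (GrMod.regular (envGrading ℬ))) n ≃+
      Ext.{u + 1} (bimod 𝒜) ((Q.envRight hB).res.obj
        (GrMod.shift (γ - ε) (GrMod.regular (tensorGrading 𝒜 (opGrading ℬ))))) (n + 1) :=
  AddEquiv.ofBijective _ (NormalQuotient.extTwo_bijective (Q.envRight hB) (Q.envRightLeft hB)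
    (Q.isReduction_right hB) (add_sub_cancel ε γ) n)

/-- The comparison map `Ext^{n + 1, G}_{A^e}(A, A^e) → Ext^{n, G}_{B^e}(B, B^e)`. -/
noncomputable def extToQuotient (n : ℕ) (γ : G) :
    Ext.{u + 1} (bimod 𝒜) (GrMod.shift (γ - ε) (GrMod.regular (envGrading 𝒜))) (n + 1) →+
      Ext.{u + 1} (bimod ℬ) (GrMod.shift γ (GrMod.regular (envGrading ℬ))) n :=
  (extTwoEquiv Q hB n γ).symm.toAddMonoidHom.comp
    ((Q.envRight hB).extProj (bimod 𝒜) (γ - ε) (n + 1))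

theorem extTwo_extToQuotient (n : ℕ) (γ : G)
    (u : Ext.{u + 1} (bimod 𝒜) (GrMod.shift (γ - ε) (GrMod.regular (envGrading 𝒜))) (n + 1)) :
    NormalQuotient.extTwo (Q.envRight hB) (Q.envRightLeft hB)
      (bimodMap Q.map_mem (Q.envRight hB).map_mem (Q.envRightLeft hB).map_mem
        (map_comp_right_left f)) (add_sub_cancel ε γ) n (extToQuotient Q hB n γ u) =
      (Q.envRight hB).extProj (bimod 𝒜) (γ - ε) (n + 1) u :=
  (extTwoEquiv Q hB n γ).apply_symm_apply _

include hvanish' E' in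
theorem extToQuotient_surjective (γ : G) : Function.Surjective (extToQuotient Q hB n γ) :=
  (extTwoEquiv Q hB n γ).symm.surjective.comp
    (extProj_right_surjective hvanish' E' Q hB (γ - ε) (n + 1))

theorem extToQuotient_eq_zero_iff (n : ℕ) (γ : G)
    (u : Ext.{u + 1} (bimod 𝒜) (GrMod.shift (γ - ε) (GrMod.regular (envGrading 𝒜))) (n + 1)) :
    extToQuotient Q hB n γ u = 0 ↔
      (Q.envRight hB).extProj (bimod 𝒜) (γ - ε) (n + 1) u = 0 :=
  EmbeddingLike.map_eq_zero_iff (f := (extTwoEquiv Q hB n γ).symm)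

/-- The comparison map is semilinear with respect to the automorphism induced by `z`. -/
theorem extToQuotient_rightMul (n : ℕ) {α β γ : G} (h : α + β = γ)
    (h' : α + (β - ε) = γ - ε) (s : envGrading 𝒜 α)
    (u : Ext.{u + 1} (bimod 𝒜) (GrMod.shift (β - ε) (GrMod.regular (envGrading 𝒜))) (n + 1)) :
    extRightMul (envGrading ℬ) (bimod ℬ) n h
        ⟨envHom f s, tensorMap_mem Q.map_mem Q.op.map_mem _ _ s.2⟩ (extToQuotient Q hB n β u) =
      extToQuotient Q hB n γ (extRightMul (envGrading 𝒜) (bimod 𝒜) (n + 1) h'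
        ⟨(tensorAut τ (1 : gradedAut (opGrading 𝒜))).1 s, ((tensorAut τ 1).2 _ _).2 s.2⟩ u) := by
  apply (NormalQuotient.extTwo_bijective (Q.envRight hB) (Q.envRightLeft hB)
    (Q.isReduction_right hB) (add_sub_cancel ε γ) n).1
  rw [extTwo_extToQuotient, (Q.envRight hB).extProj_rightMul]
  have key := NormalQuotient.extTwo_rightMul (Q.envRight hB) (Q.envRightLeft hB)
    (η := bimodMap Q.map_mem (Q.envRight hB).map_mem (Q.envRightLeft hB).map_mem
      (map_comp_right_left f)) (add_sub_cancel ε β) (add_sub_cancel ε γ) h' h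
    ⟨_, (Q.envRight hB).map_mem _ _ s.2⟩ n (extToQuotient Q hB n β u)
  rw [extTwo_extToQuotient] at key
  have e₁ : (⟨envHom f s, tensorMap_mem Q.map_mem Q.op.map_mem _ _ s.2⟩ : envGrading ℬ α) =
      ⟨_, (Q.envRightLeft hB).map_mem _ _ ((Q.envRight hB).map_mem _ _ s.2)⟩ :=
    Subtype.ext (map_comp_right_left f s.1).symm
  rw [e₁, key]
  congr 4
  refine Subtype.ext ?_
  change (tensorAut τ (1 : gradedAut (opGrading ℬ))).1 (Algebra.TensorProduct.map (AlgHom.id K A)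
    (AlgHom.op f) s.1) = Algebra.TensorProduct.map (AlgHom.id K A) (AlgHom.op f)
      ((tensorAut τ (1 : gradedAut (opGrading 𝒜))).1 s.1)
  generalize s.1 = t
  induction t using TensorProduct.induction_on with
  | zero => simp
  | add x y hx hy => simp only [map_add, hx, hy]
  | tmul a b => rfl

/-- The projection of `Ext^{n + 1}` to the quotient algebra. -/
noncomputable def cyProj (γ : G) :
    Ext.{u + 1} (bimod 𝒜) (GrMod.shift (γ - ε) (GrMod.regular (envGrading 𝒜))) (n + 1) →+
      ℬ (l - ε + γ) where
  toFun u := ⟨f (cyEquiv E' (γ - ε) u).1, by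
    rw [show l - ε + γ = l + (γ - ε) by abel]
    exact Q.map_mem _ _ (cyEquiv E' (γ - ε) u).2⟩
  map_zero' := Subtype.ext (by simp)
  map_add' _ _ := Subtype.ext (by simp)

theorem cyProj_surjective (γ : G) : Function.Surjective (cyProj Q E' γ) := fun b => by
  obtain ⟨a, ha, e⟩ := Q.exists_lift _ b.1 b.2
  rw [show l - ε + γ = l + (γ - ε) by abel] at ha
  exact ⟨(cyEquiv E' (γ - ε)).symm ⟨a, ha⟩, Subtype.ext (by simpa [cyProj] using e)⟩

theorem extProj_eq_zero_iff_cyProj (γ : G)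
    (u : Ext.{u + 1} (bimod 𝒜) (GrMod.shift (γ - ε) (GrMod.regular (envGrading 𝒜))) (n + 1)) :
    (Q.envRight hB).extProj (bimod 𝒜) (γ - ε) (n + 1) u = 0 ↔ cyProj Q E' γ u = 0 := by
  rw [(Q.envRight hB).extProj_eq_zero_iff (bimod 𝒜) (add_sub_cancel ε (γ - ε))]
  constructor
  · rintro ⟨v, rfl⟩
    refine Subtype.ext ?_
    change f (cyEquiv E' (γ - ε) _).1 = 0
    rw [cyEquiv_rightMul_right E' Q hB, map_mul, Q.map_self, zero_mul]
  · intro h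
    obtain ⟨b, hb, e⟩ := Q.exists_mul_eq (show ε + (l + (γ - ε - ε)) = l + (γ - ε) by abel)
      (cyEquiv E' (γ - ε) u).2 (congrArg Subtype.val h)
    refine ⟨(cyEquiv E' _).symm ⟨τ.1.symm b, Q.aut_symm_mem hb⟩,
      (cyEquiv E' _).injective (Subtype.ext ?_)⟩
    rw [cyEquiv_rightMul_right E' Q hB, AddEquiv.apply_symm_apply, e, Q.comm,
      AlgEquiv.apply_symm_apply]

theorem cyProj_rightMul {μ' τ' : gradedAut ℬ} (hμ : ∀ a, μ'.1 (f a) = f (μ.1 a))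
    (hτ : ∀ a, τ'.1 (f a) = f (τ.1 a)) {α β γ : G} (h' : α + (β - ε) = γ - ε)
    (s : envGrading 𝒜 α)
    (u : Ext.{u + 1} (bimod 𝒜) (GrMod.shift (β - ε) (GrMod.regular (envGrading 𝒜))) (n + 1)) :
    (cyProj Q E' γ (extRightMul (envGrading 𝒜) (bimod 𝒜) (n + 1) h'
      ⟨(tensorAut τ (1 : gradedAut (opGrading 𝒜))).1 (envSwap K A s),
        ((tensorAut τ 1).2 _ _).2 (envSwap_mem s.2)⟩ u)).1 =
      AlgHom.mulLeftRight K B (envMap (1 : gradedAut ℬ).1 (μ' * τ').1 (envHom f s))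
        (cyProj Q E' β u).1 := by
  change f (cyEquiv E' (γ - ε) _).1 = AlgHom.mulLeftRight K B _ (f (cyEquiv E' (β - ε) u).1)
  rw [cyEquiv_rightMul E' h' ⟨_, envMap_mem 1 τ _ _ s.2⟩ _ (envSwap_envMap_one τ s.1).symm,
    map_mulLeftRight, envHom_envMap hμ hτ]

/-- The top extension group of the quotient algebra, in degree `γ`. -/
noncomputable def quotientCYEquivApp (γ : G) :
    Ext.{u + 1} (bimod ℬ) (GrMod.shift γ (GrMod.regular (envGrading ℬ))) n ≃+ ℬ (l - ε + γ) :=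
  addEquivOfSurjective (extToQuotient Q hB n γ) (cyProj Q E' γ)
    (extToQuotient_surjective Q hB E' hvanish' γ) (cyProj_surjective Q E' γ) fun u =>
      (extToQuotient_eq_zero_iff Q hB n γ u).trans (extProj_eq_zero_iff_cyProj Q hB E' γ u)

theorem quotientCYEquivApp_apply (γ : G)
    (u : Ext.{u + 1} (bimod 𝒜) (GrMod.shift (γ - ε) (GrMod.regular (envGrading 𝒜))) (n + 1)) :
    quotientCYEquivApp Q hB E' hvanish' γ (extToQuotient Q hB n γ u) = cyProj Q E' γ u :=
  addEquivOfSurjective_apply _ _ _ _ _ u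

/-- The top extension bimodule of the quotient algebra. -/
noncomputable def quotientCYEquiv {μ' τ' : gradedAut ℬ} (hμ : ∀ a, μ'.1 (f a) = f (μ.1 a))
    (hτ : ∀ a, τ'.1 (f a) = f (τ.1 a)) :
    GrMod.Equiv (extBimod ℬ n) (GrMod.shift (l - ε) (twist 1 (μ' * τ') (bimod ℬ))) where
  app γ := quotientCYEquivApp Q hB E' hvanish' γ
  map_act {α β γ} h s v := by
    obtain ⟨u, rfl⟩ := extToQuotient_surjective Q hB E' hvanish' β v
    obtain ⟨t, ht, e⟩ := tensorMap_exists_lift Q.exists_lift Q.op.exists_lift α s.1 s.2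
    obtain rfl : (⟨envHom f t, tensorMap_mem Q.map_mem Q.op.map_mem _ _ ht⟩ : envGrading ℬ α) = s :=
      Subtype.ext e
    have h' : α + (β - ε) = γ - ε := by rw [← h]; abel
    have e₁ : (extBimod ℬ n).act h
        ⟨envHom f t, tensorMap_mem Q.map_mem Q.op.map_mem _ _ ht⟩ (extToQuotient Q hB n β u) = _ :=
      (congrArg (fun b => extRightMul (envGrading ℬ) (bimod ℬ) n h b (extToQuotient Q hB n β u))
        (Subtype.ext (envHom_envSwap f t).symm)).trans
        (extToQuotient_rightMul Q hB n h h' ⟨envSwap K A t, envSwap_mem ht⟩ u)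
    refine (congrArg (quotientCYEquivApp Q hB E' hvanish' γ) e₁).trans
      ((quotientCYEquivApp_apply Q hB E' hvanish' γ _).trans (Subtype.ext ?_))
    refine (cyProj_rightMul Q E' hμ hτ h' ⟨t, ht⟩ u).trans ?_
    exact congrArg (fun b => AlgHom.mulLeftRight K B
      (envMap (1 : gradedAut ℬ).1 (μ' * τ').1 (envHom f t)) b.1)
      (quotientCYEquivApp_apply Q hB E' hvanish' β u).symm

include Q in
theorem NormalQuotient.map_aut_eq_zero_iff (a : A) : f (τ.1 a) = 0 ↔ f a = 0 := by
  rw [Q.map_eq_zero_iff, Q.map_eq_zero_iff]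
  constructor
  · rintro ⟨b, hb⟩
    refine ⟨τ.1.symm b, τ.1.injective ?_⟩
    rw [map_mul, AlgEquiv.apply_symm_apply, Q.aut_self, hb]
  · rintro ⟨b, rfl⟩
    exact ⟨τ.1 b, by rw [map_mul, Q.aut_self]⟩

end QuotientCalabiYau

end SkewCY

theorem mainTheorem5 {K : Type k} {G R : Type u} [Field K] [AddCommGroup G] [DecidableEq G]
    [Ring R] [Algebra K R] (𝒜 : G → Submodule K R) [GradedAlgebra 𝒜]
    (ħ : R) (ε : G) (hdeg : ħ ∈ 𝒜 ε) (hreg : IsRegular ħ) (hnormal : SkewCY.IsNormalElement ħ)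
    (hunit : ¬ IsUnit ħ)
    (d : ℕ) (l : G) (μ : SkewCY.gradedAut 𝒜)
    (hvanish : ∀ i : ℕ, i ≠ d → (SkewCY.extBimod 𝒜 i).IsZeroModule)
    (hd : Nonempty (SkewCY.GrMod.Equiv (SkewCY.extBimod 𝒜 d)
      (SkewCY.GrMod.shift l (SkewCY.twist 1 μ (SkewCY.bimod 𝒜))))) :
    ∃ τ : SkewCY.gradedAut 𝒜, (∀ a : R, ħ * a = τ.1 a * ħ) ∧
      ∃ μ' τ' : SkewCY.gradedAut (SkewCY.quotGrading 𝒜 ħ),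
        SkewCY.IsInduced μ μ' ∧ SkewCY.IsInduced τ τ' ∧
        1 ≤ d ∧
        (∀ i : ℕ, i ≠ d - 1 →
          (SkewCY.extBimod (SkewCY.quotGrading 𝒜 ħ) i).IsZeroModule) ∧
        Nonempty (SkewCY.GrMod.Equiv (SkewCY.extBimod (SkewCY.quotGrading 𝒜 ħ) (d - 1))
          (SkewCY.GrMod.shift (l - ε)
            (SkewCY.twist 1 (μ' * τ') (SkewCY.bimod (SkewCY.quotGrading 𝒜 ħ))))) := by
  have hA : SkewCY.HasDecomposition 𝒜 := SkewCY.hasDecomposition_of_gradedAlgebra 𝒜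
  obtain ⟨τ, hτ⟩ := SkewCY.exists_normalizing_aut hA hdeg hreg hnormal
  have Q := SkewCY.normalQuotient_quotMk hA hdeg hreg hnormal τ hτ
  have hq := SkewCY.quotMk_surjective (K := K) ħ
  have hB := Q.hasDecomposition hq
  obtain ⟨E⟩ := hd
  obtain ⟨μ', hμ'⟩ := SkewCY.exists_induced_aut hq Q.map_mem Q.exists_lift μ
    (SkewCY.map_aut_eq_zero_iff E Q hB)
  obtain ⟨τ', hτ'⟩ := SkewCY.exists_induced_aut hq Q.map_mem Q.exists_lift τ
    Q.map_aut_eq_zero_iff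
  have h1 := SkewCY.one_le_of_not_isUnit E Q hB hunit
  refine ⟨τ, hτ, μ', τ', hμ', hτ', h1, fun i hi => ?_, ?_⟩
  · exact SkewCY.extBimod_quotient_isZeroModule hvanish E Q hB i (by omega)
  · obtain ⟨n, rfl⟩ := Nat.exists_eq_add_of_le' h1
    exact ⟨SkewCY.quotientCYEquiv Q hB E hvanish hμ' hτ'⟩
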